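/- Let $X\neq\{0\}$ be a complex Banach space and $T$ a bounded linear operator on $X$ with spectrum $\sigma(T)$ and resolvent $R(z,T)=(zI-T)^{-1}$. Assume that $T$ is Tadmor--Ritt, i.e. $\sigma(T)\subset\overline{\mathbb D}$ and $C(T):=\sup_{|z|>1}\|(z-1)R(z,T)\|<\infty$. Put $\theta=\arccos\frac1{C(T)}$. For $\alpha\in(0,\frac\pi2]$ let $\mathcal B_\alpha$ be the interior of the convex hull of $\{1\}\cup B_{\sin\alpha}(0)$, where $B_\rho(z_0)$ is the open disc of radius $\rho$ about $z_0$. Let $m\in\mathbb N_0$, $r\in(0,1)$, $\eta\in(\theta,\frac\pi2)$, and $$\Omega_{\eta,r}=\mathcal B_\eta\cup B_r(1),\qquad C_\eta(T)=\sup_{z\in\mathbb C\setminus\overline{\mathcal B_\eta}}\|(z-1)R(z,T)\|,$$ $$\mathcal C(r,m,\eta)=4(\sin\eta)^{m+1}\log\frac4{\cos\eta}+4\,\mathrm{Ei}\!\left(r\,\frac{m+1}2\cos\eta\right)+2\pi(1+r)^m,\qquad \mathrm{Ei}(s)=\int_s^\infty\frac{e^{-x}}x\,dx .$$ Then $C_\eta(T)<\infty$,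 and for every bounded holomorphic $f:\Omega_{\eta,r}\to\mathbb C$ the Riesz--Dunford operator $$(f\cdot z^m)(T)=\frac1{2\pi i}\int_\Gamma f(z)\,z^m\,R(z,T)\,dz$$ is well defined, independently of the choice of $\Gamma$, where $\Gamma$ is any rectifiable, positively oriented, simple closed contour in $\Omega_{\eta,r}$ which encircles the convex hull of $\{1\}\cup\overline{B_{\sin\theta}(0)}$ (this hull is $\overline{\mathcal B_\theta}$ if $\theta>0$, and it contains $\sigma(T)$), and $$\|(f\cdot z^m)(T)\|\le\frac{C_\eta(T)}{2\pi}\,\mathcal C(r,m,\eta)\,\sup_{z\in\Omega_{\eta,r}}|f(z)| .$$ -/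

import Mathlib

open Set MeasureTheory

noncomputable section

namespace TadmorRitt

/-- `T` is a Tadmor--Ritt operator: its spectrum lies in the closed unit disc and
`‖(z - 1) R(z, T)‖` is bounded over `|z| > 1`, where `R(z, T) = (z - T)⁻¹`. -/
structure IsTadmorRitt {X : Type*} [NormedAddCommGroup X] [NormedSpace ℂ X]
    (T : X →L[ℂ] X) : Prop where
  spectrum_subset : spectrum ℂ T ⊆ Metric.closedBall 0 1
  bddAbove : BddAbove ((fun z : ℂ => ‖(z - 1) • resolvent T z‖) '' {z : ℂ | 1 < ‖z‖})

/-- The constant `C(T) = sup_{|z| > 1} ‖(z - 1) R(z, T)‖`. -/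
def rittConst {X : Type*} [NormedAddCommGroup X] [NormedSpace ℂ X] (T : X →L[ℂ] X) : ℝ :=
  sSup ((fun z : ℂ => ‖(z - 1) • resolvent T z‖) '' {z : ℂ | 1 < ‖z‖})

/-- The Stolz type domain `𝓑_α`: the interior of the convex hull of the point `1` and the open
ball of radius `sin α` centred at `0`. -/
def stolz (α : ℝ) : Set ℂ :=
  interior (convexHull ℝ ({1} ∪ Metric.ball 0 (Real.sin α)))

/-- The closed Stolz type domain: the convex hull of `1` and the closed ball of radius `sin α`
centred at `0`. For `0 < α < π / 2` this is the closure of `stolz α`; for `α = 0`, where `stolz α`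
is empty, it is the segment `[0, 1]`. -/
def closedStolz (α : ℝ) : Set ℂ :=
  convexHull ℝ ({1} ∪ Metric.closedBall 0 (Real.sin α))

/-- The keyhole-shaped set `Ω_{η,r} = 𝓑_η ∪ B_r(1)`. -/
def keyhole (η r : ℝ) : Set ℂ := stolz η ∪ Metric.ball 1 r

/-- The values `‖(z - 1) R(z, T)‖` for `z` outside the closure of `𝓑_η`. -/
def sectorValues {X : Type*} [NormedAddCommGroup X] [NormedSpace ℂ X] (T : X →L[ℂ] X) (η : ℝ) :
    Set ℝ :=
  (fun z : ℂ => ‖(z - 1) • resolvent T z‖) '' (closure (stolz η))ᶜ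

/-- The constant `C_η(T) = sup_{z ∉ closure 𝓑_η} ‖(z - 1) R(z, T)‖`. -/
def sectorConst {X : Type*} [NormedAddCommGroup X] [NormedSpace ℂ X] (T : X →L[ℂ] X) (η : ℝ) :
    ℝ :=
  sSup (sectorValues T η)

/-- The exponential integral `Ei(s) = ∫_s^∞ e^{-x} / x dx`, `s > 0`. -/
def Ei (s : ℝ) : ℝ := ∫ x in Ioi s, Real.exp (-x) / x

/-- The explicit bound
`𝒞(r, m, η) = 4 (sin η)^{m+1} log (4 / cos η) + 4 Ei (r (m+1)/2 cos η) + 2π (1 + r)^m`. -/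
def keyholeConst (r : ℝ) (m : ℕ) (η : ℝ) : ℝ :=
  4 * Real.sin η ^ (m + 1) * Real.log (4 / Real.cos η)
    + 4 * Ei (r * (((m : ℝ) + 1) / 2) * Real.cos η)
    + 2 * Real.pi * (1 + r) ^ m

/-- The supremum norm of `f` over `Ω` (for `f` bounded on `Ω`). -/
def supNorm (f : ℂ → ℂ) (Ω : Set ℂ) : ℝ := sSup ((fun z => ‖f z‖) '' Ω)

/-- The contour integral `∫_γ F(z) dz` over a curve parametrized by `[0, 1]`. -/
def contourIntegral {E : Type*} [NormedAddCommGroup E] [NormedSpace ℂ E]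
    (γ : ℝ → ℂ) (F : ℂ → E) : E :=
  ∫ t in (0 : ℝ)..1, deriv γ t • F (γ t)

/-- `γ : [0, 1] → ℂ` parametrizes a rectifiable, positively oriented, simple closed contour inside
`Ω` which encircles `K`. Rectifiable curves are taken in a Lipschitz parametrization (such as the
one by constant speed); encircling `K` in the positive sense means avoiding `K` and having winding
number `1` about each of its points. -/
structure IsContourAround (K Ω : Set ℂ) (γ : ℝ → ℂ) : Prop where
  lipschitz : ∃ L : NNReal, LipschitzOnWith L γ (Icc 0 1)
  closed : γ 0 = γ 1
  simple : InjOn γ (Ico 0 1)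
  inside : ∀ t ∈ Icc (0 : ℝ) 1, γ t ∈ Ω
  avoids : ∀ t ∈ Icc (0 : ℝ) 1, γ t ∉ K
  winding : ∀ w ∈ K,
    (2 * (Real.pi : ℂ) * Complex.I)⁻¹ * contourIntegral γ (fun z => (z - w)⁻¹) = 1

/-- `A` is the Riesz--Dunford operator `g(T)`, for `g` holomorphic on `Ω`: the set `K` contains
the spectrum of `T`, contours inside `Ω` around `K` exist, and
`A = (2πi)⁻¹ ∫_γ g(z) R(z, T) dz` for every such contour `γ`. -/
structure IsRieszDunford {X : Type*} [NormedAddCommGroup X] [NormedSpace ℂ X]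
    (K Ω : Set ℂ) (T : X →L[ℂ] X) (g : ℂ → ℂ) (A : X →L[ℂ] X) : Prop where
  spectrum_subset : spectrum ℂ T ⊆ K
  exists_contour : ∃ γ : ℝ → ℂ, IsContourAround K Ω γ
  eq_integral : ∀ γ : ℝ → ℂ, IsContourAround K Ω γ →
    A = (2 * (Real.pi : ℂ) * Complex.I)⁻¹ • contourIntegral γ (fun z => g z • resolvent T z)

end TadmorRitt

end

/-! Resolvent bound. If `k C(T) < 1`, a Neumann series at a point `|z| > 1` inverts `w - T` whenever
`|w - z| ≤ k |z - 1|`, with a bound on `(w - 1) R(w, T)` independent of `w`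
(`IsTadmorRitt.resolvent_perturb`). Which `w` can be reached is decided by the point of largest
modulus on the Apollonius circle `|w - z| = k |z - 1|`: for `k = cos α` the unreached points are
enclosed by a limaçon, which lies in the closed Stolz domain of angle `α`
(`exists_one_le_norm_of_le`, `mem_closedStolz_of_le`). Taking `k` just below `cos θ` locates the
spectrum; taking it just above `cos η` gives `C_η(T) < ∞`.

Independence of the contour. No Jordan curve theorem or homology is needed. Let `A` be the value
computed on one contour around the hull `K`, with `g = f z^m`. Then `g R - (z - 1)⁻¹ A` has a
primitive on `Ω \ K` (`exists_primitive_smul_resolvent_sub`), so only the winding number about `1`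
matters for other contours. The primitive exists because the Cauchy integral of the difference
quotient of `g` continues `(g - A) R` across `K` to the star-shaped set `Ω`, while `R - (z - 1)⁻¹`
lives on a star-shaped set in the variable `1 / (z - 1)`.

Norm bound. The same primitive expresses `2πi A` as four integrals along the boundary of the keyhole
(`sum_boundary_integrals`), where `‖R‖ ≤ C_η(T) / |z - 1|`. The large arc yields the logarithm, the
two tangent rays the exponential integral, the circle about `1` the last term
(`norm_le_of_boundary`). Since `f` is holomorphic only inside, this is applied to the dilations `f(c
+ t(z - c))`, and then `t → 1` (`exists_calculus`). -/

noncomputable section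

namespace TadmorRitt

open Filter Topology Metric

/-! ### Integration along Lipschitz curves and primitives on star-shaped sets. -/

section Curves

variable {E : Type*} [NormedAddCommGroup E] [NormedSpace ℂ E]

lemma norm_deriv_le_of_lipschitz {γ : ℝ → ℂ} {L : NNReal} (hγ : LipschitzOnWith L γ (Icc 0 1))
    {t : ℝ} (ht : t ∈ Ioo (0 : ℝ) 1) : ‖deriv γ t‖ ≤ L :=
  norm_deriv_le_of_lipschitzOn (Icc_mem_nhds ht.1 ht.2) hγ

lemma ae_norm_deriv_smul_le {γ : ℝ → ℂ} {L : NNReal} (hγ : LipschitzOnWith L γ (Icc 0 1))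
    {h : ℝ → E} {B : ℝ} (hB : ∀ t ∈ Icc (0 : ℝ) 1, ‖h t‖ ≤ B) :
    ∀ᵐ t, t ∈ Ioc (0 : ℝ) 1 → ‖deriv γ t • h t‖ ≤ L * B := by
  have h1 : ∀ᵐ t : ℝ, t ≠ 1 := by simp [ae_iff, measure_singleton]
  filter_upwards [h1] with t ht1 ht
  rw [norm_smul]
  exact mul_le_mul (norm_deriv_le_of_lipschitz hγ ⟨ht.1, lt_of_le_of_ne ht.2 ht1⟩)
    (hB t ⟨ht.1.le, ht.2⟩) (norm_nonneg _) L.2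

lemma aestronglyMeasurable_deriv_smul (γ : ℝ → ℂ) {h : ℝ → E} (hh : ContinuousOn h (Icc 0 1)) :
    AEStronglyMeasurable (fun t => deriv γ t • h t) (volume.restrict (Ioc 0 1)) := by
  refine AEStronglyMeasurable.smul (measurable_deriv γ).aestronglyMeasurable ?_
  exact (hh.mono Ioc_subset_Icc_self).aestronglyMeasurable measurableSet_Ioc

lemma intervalIntegrable_deriv_smul {γ : ℝ → ℂ} {L : NNReal}
    (hγ : LipschitzOnWith L γ (Icc 0 1)) {h : ℝ → E} (hh : ContinuousOn h (Icc 0 1)) :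
    IntervalIntegrable (fun t => deriv γ t • h t) volume 0 1 := by
  obtain ⟨B, hB⟩ := isCompact_Icc.exists_bound_of_continuousOn hh
  rw [intervalIntegrable_iff_integrableOn_Ioc_of_le zero_le_one]
  refine IntegrableOn.of_bound (by simp) (aestronglyMeasurable_deriv_smul γ hh) (L * B) ?_
  rw [ae_restrict_iff' measurableSet_Ioc]
  exact ae_norm_deriv_smul_le hγ hB

lemma differentiableAt_of_lipschitz {γ : ℝ → ℂ} {L : NNReal}
    (hγ : LipschitzOnWith L γ (Icc 0 1)) :
    ∀ᵐ t, t ∈ Ioo (0 : ℝ) 1 → DifferentiableAt ℝ γ t := by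
  filter_upwards [hγ.ae_differentiableWithinAt_of_mem_real] with t h ht
  exact (h ⟨ht.1.le, ht.2.le⟩).differentiableAt (Icc_mem_nhds ht.1 ht.2)

/-- The fundamental theorem of calculus for contour integrals along Lipschitz curves. -/
theorem contourIntegral_eq_sub [CompleteSpace E] {γ : ℝ → ℂ} {L : NNReal}
    (hγ : LipschitzOnWith L γ (Icc 0 1)) {D : Set ℂ} (hD : IsOpen D)
    (hγD : ∀ t ∈ Icc (0 : ℝ) 1, γ t ∈ D) {P F : ℂ → E} (hP : ∀ z ∈ D, HasDerivAt P (F z) z) :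
    contourIntegral γ F = P (γ 1) - P (γ 0) := by
  have hPd : DifferentiableOn ℂ P D := fun z hz => (hP z hz).differentiableAt.differentiableWithinAt
  have hF : ContinuousOn F D := by
    refine (hPd.deriv hD).continuousOn.congr fun z hz => (hP z hz).deriv.symm
  have hFγ : ContinuousOn (fun t => F (γ t)) (Icc 0 1) := hF.comp hγ.continuousOn hγD
  set u : ℝ → E := fun t => deriv γ t • F (γ t) with hu
  have hint := intervalIntegrable_deriv_smul hγ hFγ
  obtain ⟨B, hB⟩ := isCompact_Icc.exists_bound_of_continuousOn hFγ
  have hB0 : 0 ≤ B := (norm_nonneg _).trans (hB 0 (by simp))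
  -- The curve is differentiable only almost everywhere. The running integral and `P ∘ γ` are both
  -- absolutely continuous with the same derivative a.e., so their difference is constant.
  have hac1 : AbsolutelyContinuousOnInterval (fun t => ∫ v in (0 : ℝ)..t, u v) 0 1 := by
    apply LipschitzOnWith.absolutelyContinuousOnInterval (K := L * B.toNNReal)
    rw [uIcc_of_le zero_le_one]
    refine LipschitzOnWith.of_dist_le_mul fun x hx y hy => ?_
    have hi : ∀ x ∈ Icc (0 : ℝ) 1, IntervalIntegrable u volume 0 x := fun x hx =>
      hint.mono_set (by rw [uIcc_of_le hx.1, uIcc_of_le zero_le_one]; exact Icc_subset_Icc_right hx.2)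
    rw [dist_eq_norm, intervalIntegral.integral_interval_sub_left (hi x hx) (hi y hy),
      Real.dist_eq]
    refine intervalIntegral.norm_integral_le_of_norm_le_const_ae ?_
    filter_upwards [ae_norm_deriv_smul_le hγ hB] with t ht hty
    have : t ∈ Ioc (0 : ℝ) 1 := by
      rcases le_total x y with h | h
      · rw [uIoc_of_ge h] at hty; exact ⟨hx.1.trans_lt hty.1, hty.2.trans hy.2⟩
      · rw [uIoc_of_le h] at hty; exact ⟨hy.1.trans_lt hty.1, hty.2.trans hx.2⟩
    simpa [hB0] using ht this
  have hac2 : AbsolutelyContinuousOnInterval (fun t => P (γ t)) 0 1 := by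
    have : LocallyLipschitzOn (Icc (0 : ℝ) 1) (fun t => P (γ t)) := by
      intro t ht
      have ha : ContDiffAt ℂ 1 P (γ t) := (hPd.analyticAt (hD.mem_nhds (hγD t ht))).contDiffAt
      obtain ⟨K, s, hs, hK⟩ := ha.exists_lipschitzOnWith
      refine ⟨K * L, Icc 0 1 ∩ γ ⁻¹' s, inter_mem self_mem_nhdsWithin
        (hγ.continuousOn t ht hs), ?_⟩
      exact hK.comp (hγ.mono inter_subset_left) fun x hx => hx.2
    obtain ⟨K, hK⟩ := this.exists_lipschitzOnWith_of_compact isCompact_Icc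
    refine LipschitzOnWith.absolutelyContinuousOnInterval (K := K) ?_
    rwa [uIcc_of_le zero_le_one]
  obtain ⟨C, hC⟩ := (hac2.sub hac1).const_of_ae_hasDerivAt_zero (by
    have h1 : ∀ᵐ t : ℝ, t ≠ 1 := by simp [ae_iff, measure_singleton]
    have h0 : ∀ᵐ t : ℝ, t ≠ 0 := by simp [ae_iff, measure_singleton]
    filter_upwards [h0, h1, differentiableAt_of_lipschitz hγ, hint.ae_hasDerivAt_integral]
      with t ht0 ht1 hd hi ht
    have ht' := ht
    rw [uIcc_of_le zero_le_one] at ht'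
    have hd' := (hd ⟨lt_of_le_of_ne ht'.1 ht0.symm, lt_of_le_of_ne ht'.2 ht1⟩).hasDerivAt
    have := ((hP _ (hγD t ht')).scomp t hd').sub (hi ht 0 (by simp))
    rwa [sub_self] at this)
  have e0 := hC 0 (by simp)
  have e1 := hC 1 (by simp)
  simp only [Pi.sub_apply, intervalIntegral.integral_same, sub_zero] at e0 e1
  rw [← e0, sub_eq_iff_eq_add] at e1
  rw [e1, add_sub_cancel_left]; rfl

theorem contourIntegral_eq_zero_of_closed [CompleteSpace E] {γ : ℝ → ℂ} {L : NNReal}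
    (hγ : LipschitzOnWith L γ (Icc 0 1)) (hcl : γ 0 = γ 1) {D : Set ℂ} (hD : IsOpen D)
    (hγD : ∀ t ∈ Icc (0 : ℝ) 1, γ t ∈ D) {P F : ℂ → E} (hP : ∀ z ∈ D, HasDerivAt P (F z) z) :
    contourIntegral γ F = 0 := by
  rw [contourIntegral_eq_sub hγ hD hγD hP, hcl, sub_self]

/-- A holomorphic function on a star-shaped open set has a primitive. -/
theorem exists_primitive_of_starConvex [CompleteSpace E] {D : Set ℂ} (hD : IsOpen D) {c : ℂ}
    (hc : StarConvex ℝ c D) {F : ℂ → E} (hF : DifferentiableOn ℂ F D) :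
    ∃ P : ℂ → E, ∀ z ∈ D, HasDerivAt P (F z) z := by
  refine ⟨fun z => ∫ t in (0 : ℝ)..1, (z - c) • F (c + t • (z - c)), fun z hz => ?_⟩
  have hstar : ∀ w ∈ D, ∀ t ∈ Icc (0 : ℝ) 1, c + t • (w - c) ∈ D := fun w hw t ht =>
    hc.add_smul_sub_mem hw ht.1 ht.2
  have hFd : ∀ w ∈ D, HasDerivAt F (deriv F w) w := fun w hw =>
    (hF.differentiableAt (hD.mem_nhds hw)).hasDerivAt
  have hFc := hF.continuousOn
  have hF'c : ContinuousOn (deriv F) D := (hF.deriv hD).continuousOn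
  obtain ⟨ε, hε, hball⟩ := Metric.isOpen_iff.1 hD z hz
  have hsub : closedBall z (ε / 2) ⊆ D := (closedBall_subset_ball (by linarith)).trans hball
  have hcont : Continuous fun p : ℂ × ℝ => c + p.2 • (p.1 - c) := by fun_prop
  have hmaps : MapsTo (fun p : ℂ × ℝ => c + p.2 • (p.1 - c)) (closedBall z (ε / 2) ×ˢ Icc 0 1) D :=
    fun p hp => hstar _ (hsub hp.1) _ hp.2
  set G : ℂ × ℝ → E := fun p => F (c + p.2 • (p.1 - c)) +
    (p.2 : ℂ) • (p.1 - c) • deriv F (c + p.2 • (p.1 - c)) with hG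
  have hGc : ContinuousOn G (closedBall z (ε / 2) ×ˢ Icc (0 : ℝ) 1) := by
    refine (hFc.comp hcont.continuousOn hmaps).add ?_
    refine ContinuousOn.smul (by fun_prop) (ContinuousOn.smul (by fun_prop) ?_)
    exact hF'c.comp hcont.continuousOn hmaps
  obtain ⟨B, hB⟩ := ((isCompact_closedBall z (ε / 2)).prod isCompact_Icc).exists_bound_of_continuousOn hGc
  have hFt : ∀ w ∈ closedBall z (ε / 2),
      ContinuousOn (fun t : ℝ => (w - c) • F (c + t • (w - c))) (Icc 0 1) := fun w hw =>
    continuousOn_const.smul (hFc.comp (by fun_prop) fun t ht => hstar w (hsub hw) t ht)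
  have hGt : ContinuousOn (fun t : ℝ => G (z, t)) (Icc 0 1) :=
    hGc.comp (by fun_prop) fun t ht => ⟨mem_closedBall_self (by positivity), ht⟩
  have hnhds : ball z (ε / 2) ∈ 𝓝 z := ball_mem_nhds z (by positivity)
  have hu : uIoc (0 : ℝ) 1 = Ioc 0 1 := uIoc_of_le zero_le_one
  have key := intervalIntegral.hasDerivAt_integral_of_dominated_loc_of_deriv_le
    (μ := volume) (a := 0) (b := 1)
    (F := fun w (t : ℝ) => (w - c) • F (c + t • (w - c))) (F' := fun w t => G (w, t)) (x₀ := z)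
    (bound := fun _ => B) hnhds
    (by
      filter_upwards [hnhds] with w hw
      rw [hu]
      exact ((hFt w (ball_subset_closedBall hw)).mono Ioc_subset_Icc_self).aestronglyMeasurable
        measurableSet_Ioc)
    (ContinuousOn.intervalIntegrable (by
      rw [uIcc_of_le zero_le_one]; exact hFt z (mem_closedBall_self (by positivity))))
    (by rw [hu]; exact (hGt.mono Ioc_subset_Icc_self).aestronglyMeasurable measurableSet_Ioc)
    (Eventually.of_forall fun t ht w hw =>
      hB (w, t) ⟨ball_subset_closedBall hw, by rw [hu] at ht; exact ⟨ht.1.le, ht.2⟩⟩)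
    (by simp)
    (Eventually.of_forall fun t ht w hw => by
      rw [hu] at ht
      have h1 : HasDerivAt (fun w : ℂ => c + t • (w - c)) (t : ℂ) w := by
        simpa using (((hasDerivAt_id w).sub_const c).const_mul (t : ℂ)).const_add c
      have h2 := (hFd _ (hstar w (hsub (ball_subset_closedBall hw)) t ⟨ht.1.le, ht.2⟩)).scomp w h1
      have h3 := ((hasDerivAt_id w).sub_const c).smul h2
      simp only [hG, id, Function.comp_def, one_smul] at h3 ⊢
      rw [add_comm, smul_comm]
      exact h3)
  -- The `z`-derivative of the integrand is also the `t`-derivative of `t F(c + t(z - c))`, so it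
  -- integrates to `F z`.
  have hval : ∫ t in (0 : ℝ)..1, G (z, t) = F z := by
    have : ∀ t ∈ uIcc (0 : ℝ) 1,
        HasDerivAt (fun t : ℝ => (t : ℂ) • F (c + t • (z - c))) (G (z, t)) t := by
      intro t ht
      rw [uIcc_of_le zero_le_one] at ht
      have h1 : HasDerivAt (fun t : ℝ => c + t • (z - c)) (z - c) t := by
        simpa using ((hasDerivAt_id t).smul_const (z - c)).const_add c
      have h2 := (hFd _ (hstar z hz t ht)).scomp t h1
      have h3 := (Complex.ofRealCLM.hasDerivAt (x := t)).smul h2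
      simp only [hG, Complex.ofRealCLM_apply, Complex.ofReal_one, one_smul, Function.comp_def]
        at h3 ⊢
      rw [add_comm]
      exact h3
    rw [intervalIntegral.integral_eq_sub_of_hasDerivAt this
      (ContinuousOn.intervalIntegrable (by rwa [uIcc_of_le zero_le_one]))]
    simp
  rw [← hval]
  exact key.2

end Curves

/-! ### Resolvents and the Riesz--Dunford integral. -/

section Calculus

variable {𝒜 : Type*} [NormedRing 𝒜] [NormedAlgebra ℂ 𝒜]

lemma sub_mul_resolvent {a : 𝒜} {z : ℂ} (hz : z ∈ resolventSet ℂ a) :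
    (algebraMap ℂ 𝒜 z - a) * resolvent a z = 1 :=
  Ring.mul_inverse_cancel _ (spectrum.mem_resolventSet_iff.1 hz)

lemma resolvent_mul_sub {a : 𝒜} {z : ℂ} (hz : z ∈ resolventSet ℂ a) :
    resolvent a z * (algebraMap ℂ 𝒜 z - a) = 1 :=
  Ring.inverse_mul_cancel _ (spectrum.mem_resolventSet_iff.1 hz)

lemma resolvent_identity {a : 𝒜} {z w : ℂ} (hz : z ∈ resolventSet ℂ a)
    (hw : w ∈ resolventSet ℂ a) :
    resolvent a w - resolvent a z = (z - w) • (resolvent a w * resolvent a z) := by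
  have h : (z - w) • (1 : 𝒜) = (algebraMap ℂ 𝒜 z - a) - (algebraMap ℂ 𝒜 w - a) := by
    rw [sub_sub_sub_cancel_right, ← map_sub, Algebra.algebraMap_eq_smul_one]
  calc resolvent a w - resolvent a z
      = resolvent a w * ((algebraMap ℂ 𝒜 z - a) * resolvent a z)
        - (resolvent a w * (algebraMap ℂ 𝒜 w - a)) * resolvent a z := by
        rw [sub_mul_resolvent hz, resolvent_mul_sub hw, mul_one, one_mul]
    _ = resolvent a w * ((z - w) • (1 : 𝒜)) * resolvent a z := by rw [h]; noncomm_ring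
    _ = _ := by rw [mul_smul_comm, mul_one, smul_mul_assoc]

lemma intervalIntegrable_mul_right {u : ℝ → 𝒜} {x y : ℝ} (hu : IntervalIntegrable u volume x y)
    (b : 𝒜) : IntervalIntegrable (fun t => u t * b) volume x y := by
  rw [intervalIntegrable_iff] at hu ⊢
  exact ((ContinuousLinearMap.mul ℂ 𝒜).flip b).integrable_comp hu

variable [CompleteSpace 𝒜]

lemma differentiableOn_resolvent {a : 𝒜} {K : Set ℂ} (hσ : spectrum ℂ a ⊆ K) :
    DifferentiableOn ℂ (resolvent a) Kᶜ := fun _ hz =>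
  (spectrum.hasDerivAt_resolvent_const_left
    (by_contra fun h => hz (hσ h))).differentiableAt.differentiableWithinAt

/-- Outside a compact set `K ⊇ σ(a)`, star-shaped about `1`, the function
`R(z, a) - (z - 1)⁻¹` has a primitive. -/
theorem exists_primitive_resolvent_sub {a : 𝒜} {K : Set ℂ} (hK : IsCompact K)
    (hK1 : StarConvex ℝ 1 K) (h1 : (1 : ℂ) ∈ K) (hσ : spectrum ℂ a ⊆ K) :
    ∃ P : ℂ → 𝒜, ∀ z ∈ Kᶜ, HasDerivAt P (resolvent a z - (z - 1)⁻¹ • 1) z := by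
  -- Under `w = 1 / (z - 1)`, with `∞` sent to `0`, the complement of `K` becomes `V`, and
  -- star-shapedness of `K` about `1` becomes star-shapedness of `V` about `0`.
  set V : Set ℂ := {w | ∀ v ∈ K, w * (v - 1) ≠ 1} with hV
  have hVo : IsOpen V := by
    rw [isOpen_iff_mem_nhds]
    intro w hw
    refine hK.eventually_forall_of_forall_eventually fun v hv => ?_
    exact ContinuousAt.eventually_ne (g := fun p : ℂ × ℂ => p.1 * (p.2 - 1)) (by fun_prop) (hw v hv)
  have hVs : StarConvex ℝ 0 V := by
    rw [starConvex_zero_iff]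
    intro w hw t ht0 ht1 v hv h
    refine hw _ (hK1.add_smul_sub_mem hv ht0 ht1) ?_
    simp only [Complex.real_smul] at h ⊢; linear_combination h
  -- With `w = 1 / (z - 1)` one has `R(z) = w W(w)`, hence `R(z) - w = w² (a - 1) W(w)`. Since
  -- `dw/dz = -w²`, a primitive `Q` of `(a - 1) W` gives the primitive `-Q(1 / (z - 1))`.
  set W : ℂ → 𝒜 := fun w => Ring.inverse (1 - w • (a - 1)) with hW
  have hWu : ∀ w ∈ V, IsUnit (1 - w • (a - 1)) := by
    intro w hw
    rcases eq_or_ne w 0 with rfl | hw0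
    · simp
    have hn : 1 + w⁻¹ ∉ K := fun h => hw _ h (by field_simp; ring)
    have hu : IsUnit (algebraMap ℂ 𝒜 (1 + w⁻¹) - a) :=
      spectrum.mem_resolventSet_iff.1 (by_contra fun h => hn (hσ h))
    have : 1 - w • (a - 1) = (Units.mk0 w hw0) • (algebraMap ℂ 𝒜 (1 + w⁻¹) - a) := by
      rw [Units.smul_def, Units.val_mk0, Algebra.algebraMap_eq_smul_one, smul_sub, smul_sub,
        smul_smul, mul_add, mul_inv_cancel₀ hw0, add_smul]
      simp only [mul_one, one_smul]; abel
    rw [this]; exact hu.smul _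
  have hWd : DifferentiableOn ℂ (fun w => (a - 1) * W w) V := by
    intro w hw
    refine DifferentiableAt.differentiableWithinAt (DifferentiableAt.const_mul ?_ _)
    have := differentiableAt_inverse (𝕜 := ℂ) (hWu w hw)
    exact this.comp w (f := fun w : ℂ => (1 : 𝒜) - w • (a - 1)) (by fun_prop)
  obtain ⟨Q, hQ⟩ := exists_primitive_of_starConvex hVo hVs hWd
  refine ⟨fun z => -Q ((z - 1)⁻¹), fun z hz => ?_⟩
  have hz1 : z - 1 ≠ 0 := fun h => hz (by rwa [sub_eq_zero.1 h])
  have hzr : z ∈ resolventSet ℂ a := by_contra fun h => hz (hσ h)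
  have hzV : (z - 1)⁻¹ ∈ V := by
    intro v hv h
    have : v = z := by field_simp at h; linear_combination h
    exact hz (this ▸ hv)
  have hWz : W (z - 1)⁻¹ = (z - 1) • resolvent a z := by
    have e : 1 - (z - 1)⁻¹ • (a - 1) = (z - 1)⁻¹ • (algebraMap ℂ 𝒜 z - a) := by
      rw [eq_inv_smul_iff₀ hz1, smul_sub, smul_smul, mul_inv_cancel₀ hz1,
        Algebra.algebraMap_eq_smul_one, sub_smul]
      simp
    refine Ring.inverse_unit (⟨1 - (z - 1)⁻¹ • (a - 1), (z - 1) • resolvent a z, ?_, ?_⟩ : 𝒜ˣ)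
    · rw [e, smul_mul_smul_comm, inv_mul_cancel₀ hz1, sub_mul_resolvent hzr, one_smul]
    · rw [e, smul_mul_smul_comm, mul_inv_cancel₀ hz1, resolvent_mul_sub hzr, one_smul]
  have hd := ((hQ _ hzV).scomp z (((hasDerivAt_id z).sub_const 1).inv hz1)).neg
  convert! hd using 1
  have hid : (a - 1) * resolvent a z = (z - 1) • resolvent a z - 1 := by
    have h := sub_mul_resolvent hzr
    rw [sub_mul, Algebra.algebraMap_eq_smul_one, smul_mul_assoc, one_mul] at h
    rw [sub_mul, one_mul, sub_smul, one_smul, ← h]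
    abel
  simp only [id]
  rw [hWz, mul_smul_comm, hid, smul_smul, ← neg_smul, smul_sub, smul_smul]
  congr 1
  · nth_rw 1 [← one_smul ℂ (resolvent a z)]
    congr 1; field_simp
  · congr 1; field_simp

lemma continuousOn_comp_contour {E : Type*} [NormedAddCommGroup E] {K Ω : Set ℂ} {γ : ℝ → ℂ}
    (hγ : IsContourAround K Ω γ) {F : ℂ → E} (hF : ContinuousOn F (Ω \ K)) :
    ContinuousOn (fun t => F (γ t)) (Icc 0 1) := by
  obtain ⟨L, hL⟩ := hγ.lipschitz
  exact hF.comp hL.continuousOn fun t ht => ⟨hγ.inside t ht, hγ.avoids t ht⟩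

lemma contourIntegral_inv_sub {K Ω : Set ℂ} {γ : ℝ → ℂ} (hγ : IsContourAround K Ω γ) {w : ℂ}
    (hw : w ∈ K) :
    contourIntegral γ (fun z => (z - w)⁻¹) = 2 * (Real.pi : ℂ) * Complex.I := by
  have := hγ.winding w hw
  rwa [inv_mul_eq_iff_eq_mul₀ Complex.two_pi_I_ne_zero, mul_one] at this

lemma contourIntegral_smul_const {E : Type*} [NormedAddCommGroup E] [NormedSpace ℂ E]
    [CompleteSpace E] (γ : ℝ → ℂ) (φ : ℂ → ℂ) (e : E) :
    contourIntegral γ (fun z => φ z • e) = contourIntegral γ φ • e := by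
  simp only [contourIntegral, smul_smul, smul_eq_mul]
  exact intervalIntegral.integral_smul_const _ _

/-- A contour integral of a function which is holomorphic up to a pole with primitive. -/
theorem contourIntegral_eq_of_primitive {E : Type*} [NormedAddCommGroup E] [NormedSpace ℂ E]
    [CompleteSpace E] {K Ω : Set ℂ} (hK : IsClosed K) (hΩ : IsOpen Ω) {w : ℂ} (hw : w ∈ K)
    {γ : ℝ → ℂ} (hγ : IsContourAround K Ω γ) {F P : ℂ → E} {e : E}
    (hF : ContinuousOn F (Ω \ K))
    (hP : ∀ z ∈ Ω \ K, HasDerivAt P (F z - (z - w)⁻¹ • e) z) :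
    contourIntegral γ F = (2 * (Real.pi : ℂ) * Complex.I) • e := by
  obtain ⟨L, hL⟩ := hγ.lipschitz
  have h0 := contourIntegral_eq_zero_of_closed hL hγ.closed (hΩ.sdiff hK)
    (fun t ht => ⟨hγ.inside t ht, hγ.avoids t ht⟩) hP
  have hinv : ContinuousOn (fun z : ℂ => (z - w)⁻¹ • e) (Ω \ K) := by
    refine ContinuousOn.smul (ContinuousOn.inv₀ (by fun_prop) fun z hz => ?_) continuousOn_const
    exact fun h => hz.2 (by rwa [sub_eq_zero.1 h])
  rw [← contourIntegral_inv_sub hγ hw, ← contourIntegral_smul_const, ← sub_eq_zero, ← h0]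
  simp only [contourIntegral, smul_sub]
  exact (intervalIntegral.integral_sub
    (intervalIntegrable_deriv_smul hL (continuousOn_comp_contour hγ hF))
    (intervalIntegrable_deriv_smul hL (continuousOn_comp_contour hγ hinv))).symm

/-- The Cauchy transform of a continuous density on a Lipschitz curve is holomorphic off the
curve. -/
theorem differentiableAt_cauchyTransform {E : Type*} [NormedAddCommGroup E] [NormedSpace ℂ E]
    [CompleteSpace E] {γ : ℝ → ℂ} {L : NNReal} (hγ : LipschitzOnWith L γ (Icc 0 1))
    {h : ℝ → E} (hh : ContinuousOn h (Icc 0 1)) {z : ℂ} (hz : z ∉ γ '' Icc 0 1) :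
    DifferentiableAt ℂ (fun z => ∫ t in (0 : ℝ)..1, deriv γ t • (γ t - z)⁻¹ • h t) z := by
  have hcl : IsClosed (γ '' Icc 0 1) := (isCompact_Icc.image_of_continuousOn hγ.continuousOn).isClosed
  obtain ⟨ε, hε, hball⟩ := Metric.isOpen_iff.1 hcl.isOpen_compl z hz
  have hne : ∀ w ∈ closedBall z (ε / 2), ∀ t ∈ Icc (0 : ℝ) 1, γ t - w ≠ 0 := fun w hw t ht h0 =>
    hball (closedBall_subset_ball (by linarith) hw) (by rw [← sub_eq_zero.1 h0]; exact ⟨t, ht, rfl⟩)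
  have hGc : ContinuousOn (fun p : ℂ × ℝ => ((γ p.2 - p.1) ^ 2)⁻¹ • h p.2)
      (closedBall z (ε / 2) ×ˢ Icc (0 : ℝ) 1) := by
    have h1 : ContinuousOn (fun p : ℂ × ℝ => γ p.2) (closedBall z (ε / 2) ×ˢ Icc (0 : ℝ) 1) :=
      hγ.continuousOn.comp continuousOn_snd fun p hp => hp.2
    refine ContinuousOn.smul (ContinuousOn.inv₀ ((h1.sub continuousOn_fst).pow 2)
      fun p hp => pow_ne_zero 2 (hne _ hp.1 _ hp.2)) ?_
    exact hh.comp continuousOn_snd fun p hp => hp.2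
  obtain ⟨B, hB⟩ := ((isCompact_closedBall z (ε / 2)).prod isCompact_Icc).exists_bound_of_continuousOn hGc
  have hFt : ∀ w ∈ closedBall z (ε / 2),
      ContinuousOn (fun t : ℝ => (γ t - w)⁻¹ • h t) (Icc 0 1) := fun w hw =>
    ContinuousOn.smul (ContinuousOn.inv₀ (hγ.continuousOn.sub continuousOn_const) (hne w hw)) hh
  have hGt : ContinuousOn (fun t : ℝ => ((γ t - z) ^ 2)⁻¹ • h t) (Icc 0 1) :=
    hGc.comp (f := fun t : ℝ => (z, t)) (by fun_prop)
      fun t ht => ⟨mem_closedBall_self (by positivity), ht⟩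
  have hnhds : ball z (ε / 2) ∈ 𝓝 z := ball_mem_nhds z (by positivity)
  have hu : uIoc (0 : ℝ) 1 = Ioc 0 1 := uIoc_of_le zero_le_one
  have key := intervalIntegral.hasDerivAt_integral_of_dominated_loc_of_deriv_le
    (μ := volume) (a := 0) (b := 1)
    (F := fun w (t : ℝ) => deriv γ t • (γ t - w)⁻¹ • h t)
    (F' := fun w t => deriv γ t • ((γ t - w) ^ 2)⁻¹ • h t) (x₀ := z)
    (bound := fun _ => L * B) hnhds
    (by
      filter_upwards [hnhds] with w hw
      rw [hu]
      exact aestronglyMeasurable_deriv_smul γ (hFt w (ball_subset_closedBall hw)))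
    (intervalIntegrable_deriv_smul hγ (hFt z (mem_closedBall_self (by positivity))))
    (by rw [hu]; exact aestronglyMeasurable_deriv_smul γ hGt)
    (by
      have h1 : ∀ᵐ t : ℝ, t ≠ 1 := by simp [ae_iff, measure_singleton]
      filter_upwards [h1] with t ht1 ht w hw
      rw [hu] at ht
      rw [norm_smul]
      exact mul_le_mul (norm_deriv_le_of_lipschitz hγ ⟨ht.1, lt_of_le_of_ne ht.2 ht1⟩)
        (hB (w, t) ⟨ball_subset_closedBall hw, ht.1.le, ht.2⟩) (norm_nonneg _) L.2)
    (by simp)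
    (Eventually.of_forall fun t ht w hw => by
      rw [hu] at ht
      have h1 := ((hasDerivAt_id w).const_sub (γ t)).inv
        (hne w (ball_subset_closedBall hw) t ⟨ht.1.le, ht.2⟩)
      have h3 := (h1.smul_const (h t)).const_smul (deriv γ t)
      simpa using! h3)
  exact key.2.differentiableAt

lemma integral_mul_right {u : ℝ → 𝒜} {x y : ℝ} (hu : IntervalIntegrable u volume x y) (b : 𝒜) :
    ∫ t in x..y, u t * b = (∫ t in x..y, u t) * b :=
  ((ContinuousLinearMap.mul ℂ 𝒜).flip b).intervalIntegral_comp_comm hu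

/-- For `g` holomorphic on a star-shaped open set `D ⊇ K ⊇ σ(a)`, and `A = g(a)` computed by means
of a contour around `K`, the function `g(z) R(z, a) - (z - 1)⁻¹ A` has a primitive on `D \ K`. -/
theorem exists_primitive_smul_resolvent_sub {a : 𝒜} {K D D' : Set ℂ} {c : ℂ} (hK : IsCompact K)
    (hK1 : StarConvex ℝ 1 K) (h1 : (1 : ℂ) ∈ K) (hσ : spectrum ℂ a ⊆ K) (hD : IsOpen D)
    (hDc : StarConvex ℝ c D) {g : ℂ → ℂ} (hg : DifferentiableOn ℂ g D)
    {γ : ℝ → ℂ} (hD' : D' ⊆ D) (hγ' : IsContourAround K D' γ) :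
    ∃ P : ℂ → 𝒜, ∀ z ∈ D \ K, HasDerivAt P (g z • resolvent a z - (z - 1)⁻¹ •
      ((2 * (Real.pi : ℂ) * Complex.I)⁻¹ • contourIntegral γ (fun z => g z • resolvent a z))) z := by
  have hγ : IsContourAround K D γ :=
    { hγ' with inside := fun t ht => hD' (hγ'.inside t ht) }
  set J : ℂ := 2 * (Real.pi : ℂ) * Complex.I with hJ
  have hJ0 : J ≠ 0 := Complex.two_pi_I_ne_zero
  set A : 𝒜 := J⁻¹ • contourIntegral γ (fun z => g z • resolvent a z) with hA
  obtain ⟨L, hL⟩ := hγ.lipschitz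
  obtain ⟨PR, hPR⟩ := exists_primitive_resolvent_sub hK hK1 h1 hσ
  have hRd := differentiableOn_resolvent hσ
  have hRc : ContinuousOn (resolvent a) (D \ K) := hRd.continuousOn.mono fun z hz => hz.2
  have hgc : ContinuousOn g (D \ K) := hg.continuousOn.mono fun z hz => hz.1
  have hres : ∀ z ∉ K, z ∈ resolventSet ℂ a := fun z hz => by_contra fun h => hz (hσ h)
  have hRint : contourIntegral γ (resolvent a) = J • (1 : 𝒜) :=
    contourIntegral_eq_of_primitive hK.isClosed hD h1 hγ hRc fun z hz => hPR z hz.2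
  set N : Set ℂ := γ '' Icc 0 1 with hN
  have hNc : IsClosed N := (isCompact_Icc.image_of_continuousOn hL.continuousOn).isClosed
  have hRγ := continuousOn_comp_contour hγ hRc
  have hgγ := continuousOn_comp_contour hγ hgc
  have hinvγ : ∀ z ∉ N, ContinuousOn (fun t => (γ t - z)⁻¹) (Icc 0 1) := fun z hz =>
    ContinuousOn.inv₀ (hL.continuousOn.sub continuousOn_const)
      fun t ht h => hz ⟨t, ht, sub_eq_zero.1 h⟩
  -- The Cauchy integral of the difference quotient of `g` against `R`. It is holomorphic off the
  -- curve, in particular near `K`, and off `K` and the curve the resolvent identity turns it into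
  -- `(g - A) R`.
  set S : ℂ → 𝒜 := fun z =>
    J⁻¹ • ∫ t in (0 : ℝ)..1, deriv γ t • (γ t - z)⁻¹ • (g (γ t) - g z) • resolvent a (γ t) with hS
  have hSd : ∀ z ∈ D \ N, DifferentiableAt ℂ S z := by
    intro z hz
    have d1 := differentiableAt_cauchyTransform hL (hgγ.smul hRγ) hz.2
    have d2 := differentiableAt_cauchyTransform hL hRγ hz.2
    have d3 := (d1.sub ((hg.differentiableAt (hD.mem_nhds hz.1)).smul d2)).const_smul J⁻¹
    refine d3.congr_of_eventuallyEq ?_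
    filter_upwards [hNc.isOpen_compl.mem_nhds hz.2] with w hw
    simp only [hS, Pi.smul_apply, Pi.sub_apply, Pi.smul_apply']
    congr 1
    rw [← intervalIntegral.integral_smul, ← intervalIntegral.integral_sub]
    · congr 1; ext t
      rw [sub_smul, smul_sub, smul_sub]
      congr 1
      rw [smul_comm (g w), smul_comm (g w)]
    · exact intervalIntegrable_deriv_smul hL ((hinvγ w hw).smul (hgγ.smul hRγ))
    · exact (intervalIntegrable_deriv_smul hL ((hinvγ w hw).smul hRγ)).smul (g w)
  have hSeq : ∀ z ∈ D \ K, z ∉ N → S z = g z • resolvent a z - A * resolvent a z := by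
    intro z hz hzN
    have hds : DifferentiableOn ℂ (dslope g z) D :=
      (Complex.differentiableOn_dslope (hD.mem_nhds hz.1)).2 hg
    -- The difference quotient of `g` is holomorphic on a star-shaped set, so its integral over the
    -- closed curve vanishes.
    obtain ⟨Q, hQ⟩ := exists_primitive_of_starConvex hD hDc hds
    have h0 := contourIntegral_eq_zero_of_closed hL hγ.closed hD hγ.inside hQ
    have hdc : ContinuousOn (fun t => dslope g z (γ t)) (Icc 0 1) :=
      hds.continuousOn.comp hL.continuousOn hγ.inside
    have e : ∀ t ∈ uIcc (0 : ℝ) 1,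
        deriv γ t • (γ t - z)⁻¹ • (g (γ t) - g z) • resolvent a (γ t)
        = (deriv γ t • dslope g z (γ t)) • resolvent a z
          - ((deriv γ t • g (γ t) • resolvent a (γ t)) * resolvent a z
            - g z • ((deriv γ t • resolvent a (γ t)) * resolvent a z)) := by
      intro t ht
      rw [uIcc_of_le zero_le_one] at ht
      have hne : γ t ≠ z := fun h => hzN ⟨t, ht, h⟩
      have hne' : γ t - z ≠ 0 := sub_ne_zero.2 hne
      have hri := resolvent_identity (hres z hz.2) (hres _ (hγ.avoids t ht))
      rw [dslope_of_ne _ hne, slope_def_field]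
      have : resolvent a (γ t) = resolvent a z + (z - γ t) • (resolvent a (γ t) * resolvent a z) := by
        rw [← hri]; abel
      have e2 : (γ t - z)⁻¹ • (g (γ t) - g z) • resolvent a (γ t)
          = ((g (γ t) - g z) / (γ t - z)) • resolvent a z
            - (g (γ t) - g z) • (resolvent a (γ t) * resolvent a z) := by
        conv_lhs => rw [this]
        have hc : (γ t - z)⁻¹ * (g (γ t) - g z) * (z - γ t) = -(g (γ t) - g z) := by
          field_simp; ring
        rw [smul_add, smul_add, smul_smul, smul_smul, smul_smul, div_eq_inv_mul, hc, neg_smul,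
          ← sub_eq_add_neg]
      rw [e2, smul_sub, smul_smul, smul_eq_mul, sub_smul, smul_sub]
      simp only [smul_mul_assoc]
      rw [smul_comm (g z)]
    have igR : IntervalIntegrable (fun t => deriv γ t • g (γ t) • resolvent a (γ t)) volume 0 1 :=
      intervalIntegrable_deriv_smul hL (hgγ.smul hRγ)
    have iR : IntervalIntegrable
        (fun t => g z • (deriv γ t • resolvent a (γ t) * resolvent a z)) volume 0 1 :=
      (intervalIntegrable_mul_right (intervalIntegrable_deriv_smul hL hRγ) (resolvent a z)).smul (g z)
    have iS : IntervalIntegrable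
        (fun t => (deriv γ t • dslope g z (γ t)) • resolvent a z) volume 0 1 := by
      simpa only [smul_assoc] using intervalIntegrable_deriv_smul hL
        (h := fun t => dslope g z (γ t) • resolvent a z) (hdc.smul continuousOn_const)
    simp only [hS]
    rw [intervalIntegral.integral_congr e, intervalIntegral.integral_sub,
      intervalIntegral.integral_smul_const, intervalIntegral.integral_sub,
      intervalIntegral.integral_smul,
      integral_mul_right igR,
      integral_mul_right (intervalIntegrable_deriv_smul hL hRγ)]
    · have i1 : ∫ t in (0 : ℝ)..1, deriv γ t • dslope g z (γ t) = 0 := h0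
      have i2 : ∫ t in (0 : ℝ)..1, deriv γ t • g (γ t) • resolvent a (γ t) = J • A := by
        rw [hA, smul_inv_smul₀ hJ0]; rfl
      have i3 : ∫ t in (0 : ℝ)..1, deriv γ t • resolvent a (γ t) = J • (1 : 𝒜) := hRint
      rw [i1, i2, i3, zero_smul, zero_sub, neg_sub, smul_mul_assoc, smul_mul_assoc, one_mul,
        smul_comm (g z), ← smul_sub, inv_smul_smul₀ hJ0]
    · exact intervalIntegrable_mul_right igR _
    · exact iR
    · exact iS
    · exact (intervalIntegrable_mul_right igR _).sub iR
  classical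
  -- Gluing gives a holomorphic function on all of `D`: holomorphy of `S` on the curve itself is not
  -- known, but there the explicit formula applies.
  set S' : ℂ → 𝒜 := fun z => if z ∈ K then S z else g z • resolvent a z - A * resolvent a z with hS'
  have hS'd : DifferentiableOn ℂ S' D := by
    intro z hz
    refine DifferentiableAt.differentiableWithinAt ?_
    by_cases hzK : z ∈ K
    · have hzN : z ∉ N := by
        rintro ⟨t, ht, rfl⟩; exact hγ.avoids t ht hzK
      refine (hSd z ⟨hz, hzN⟩).congr_of_eventuallyEq ?_
      filter_upwards [hNc.isOpen_compl.mem_nhds hzN, hD.mem_nhds hz] with w hwN hwD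
      simp only [hS']
      split_ifs with hwK
      · rfl
      · exact (hSeq w ⟨hwD, hwK⟩ hwN).symm
    · have hR' := hRd.differentiableAt (hK.isClosed.isOpen_compl.mem_nhds hzK)
      refine (((hg.differentiableAt (hD.mem_nhds hz)).smul hR').sub
        (hR'.const_mul A)).congr_of_eventuallyEq ?_
      filter_upwards [hK.isClosed.isOpen_compl.mem_nhds hzK] with w hw
      simp only [hS']
      rw [if_neg hw]; rfl
  obtain ⟨Q, hQ⟩ := exists_primitive_of_starConvex hD hDc hS'd
  -- Uses `g R - (z - 1)⁻¹ A = (g R - A R) + A (R - (z - 1)⁻¹)`.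
  refine ⟨fun z => Q z + A * PR z, fun z hz => ?_⟩
  have := (hQ z hz.1).add ((hPR z hz.2).const_mul A)
  convert! this using 1
  simp only [hS']
  rw [if_neg hz.2, mul_sub, mul_smul_comm, mul_one]
  abel

end Calculus

/-! ### Stolz domains, the limaçon and Apollonius circles. -/

section Geometry

lemma sq_norm_sub_one (w : ℂ) : ‖w - 1‖ ^ 2 = (w.re - 1) ^ 2 + w.im ^ 2 := by
  rw [← Complex.normSq_eq_norm_sq, Complex.normSq_apply]; simp; ring

lemma sq_norm_eq (w : ℂ) : ‖w‖ ^ 2 = w.re ^ 2 + w.im ^ 2 := by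
  rw [← Complex.normSq_eq_norm_sq, Complex.normSq_apply]; ring

lemma one_mem_closedStolz (α : ℝ) : (1 : ℂ) ∈ closedStolz α :=
  subset_convexHull _ _ (by simp)

lemma closedBall_subset_closedStolz (α : ℝ) : closedBall 0 (Real.sin α) ⊆ closedStolz α :=
  subset_union_right.trans (subset_convexHull _ _)

lemma mem_closedStolz_iff {α : ℝ} (hα : 0 ≤ Real.sin α) {w : ℂ} :
    w ∈ closedStolz α ↔ ∃ t ∈ Icc (0 : ℝ) 1, ∃ v ∈ closedBall (0 : ℂ) (Real.sin α),
      (1 - t) • (1 : ℂ) + t • v = w := by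
  have hne : (closedBall (0 : ℂ) (Real.sin α)).Nonempty := nonempty_closedBall.2 hα
  rw [closedStolz, singleton_union, convexHull_insert hne, mem_convexJoin,
    (convex_closedBall (0 : ℂ) _).convexHull_eq]
  constructor
  · rintro ⟨a, rfl, v, hv, p, q, hp, hq, hpq, rfl⟩
    exact ⟨q, ⟨hq, by linarith⟩, v, hv, by rw [← hpq]; simp⟩
  · rintro ⟨t, ht, v, hv, rfl⟩
    exact ⟨1, rfl, v, hv, 1 - t, t, by linarith [ht.2], ht.1, by ring, rfl⟩

lemma isCompact_closedStolz {α : ℝ} (hα : 0 ≤ Real.sin α) : IsCompact (closedStolz α) := by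
  have : closedStolz α = (fun p : ℝ × ℂ => (1 - p.1) • (1 : ℂ) + p.1 • p.2) ''
      (Icc (0 : ℝ) 1 ×ˢ closedBall (0 : ℂ) (Real.sin α)) := by
    ext w
    rw [mem_closedStolz_iff hα]
    constructor
    · rintro ⟨t, ht, v, hv, rfl⟩; exact ⟨(t, v), ⟨ht, hv⟩, rfl⟩
    · rintro ⟨⟨t, v⟩, ⟨ht, hv⟩, rfl⟩; exact ⟨t, ht, v, hv, rfl⟩
  rw [this]
  exact (isCompact_Icc.prod (isCompact_closedBall _ _)).image (by fun_prop)

lemma starConvex_closedStolz (α : ℝ) : StarConvex ℝ 1 (closedStolz α) :=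
  (convex_convexHull ℝ _) (one_mem_closedStolz α)

/-- The part of the plane bounded by the limaçon `ρ = 2 (cos ψ - cos α)` (in polar coordinates
`w = 1 - ρ e^{iψ}`) lies in the closed Stolz domain. -/
lemma mem_closedStolz_of_le {α : ℝ} (hs : 0 ≤ Real.sin α) (hk : 0 ≤ Real.cos α) {w : ℂ}
    (h : ‖w - 1‖ ^ 2 + 2 * Real.cos α * ‖w - 1‖ ≤ 2 * (1 - w.re)) : w ∈ closedStolz α := by
  set k := Real.cos α
  set ρ := ‖w - 1‖ with hρ
  have hsk : Real.sin α ^ 2 + k ^ 2 = 1 := Real.sin_sq_add_cos_sq α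
  have hρ0 : 0 ≤ ρ := norm_nonneg _
  have hw2 := sq_norm_sub_one w
  rw [← hρ] at hw2
  -- If `ρ ≥ k`, then `|w|² = 1 - 2(1 - Re w) + ρ² ≤ 1 - 2kρ ≤ sin² α`. Otherwise `w` lies on the
  -- segment from `1` to the point at distance `k` from `1` in the same direction, and the
  -- hypothesis puts that point in the disc.
  rcases le_or_gt k ρ with hkρ | hkρ
  · refine closedBall_subset_closedStolz α ?_
    rw [mem_closedBall_zero_iff]
    refine abs_le_of_sq_le_sq' ?_ hs |>.2
    rw [sq_norm_eq]
    nlinarith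
  · have hk0 : 0 < k := hρ0.trans_lt hkρ
    rcases hρ0.eq_or_lt with h0 | h0
    · have : w - 1 = 0 := norm_eq_zero.1 h0.symm
      rw [sub_eq_zero.1 this]; exact one_mem_closedStolz α
    rw [mem_closedStolz_iff hs]
    refine ⟨ρ / k, ⟨by positivity, (div_le_one hk0).2 hkρ.le⟩, 1 + (k / ρ) • (w - 1), ?_, ?_⟩
    · rw [mem_closedBall_zero_iff]
      refine abs_le_of_sq_le_sq' ?_ hs |>.2
      rw [sq_norm_eq]
      have hkx : k * ρ ≤ 1 - w.re := by nlinarith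
      have e : (1 + (k / ρ) • (w - 1)).re ^ 2 + (1 + (k / ρ) • (w - 1)).im ^ 2
          = 1 - 2 * (k / ρ) * (1 - w.re) + (k / ρ) ^ 2 * ρ ^ 2 := by
        rw [hw2]; simp; ring
      rw [e, ← mul_pow, div_mul_cancel₀ _ h0.ne']
      have : k / ρ * (k * ρ) ≤ k / ρ * (1 - w.re) := mul_le_mul_of_nonneg_left hkx (by positivity)
      have e2 : k / ρ * (k * ρ) = k ^ 2 := by field_simp
      nlinarith
    · have : (k : ℂ) ≠ 0 := by exact_mod_cast hk0.ne'
      have : (ρ : ℂ) ≠ 0 := by exact_mod_cast h0.ne'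
      simp only [Complex.real_smul]
      push_cast
      field_simp
      ring

lemma exists_norm_eq_one_mul (a : ℂ) : ∃ e : ℂ, ‖e‖ = 1 ∧ a = ‖a‖ * e := by
  rcases eq_or_ne a 0 with rfl | h
  · exact ⟨1, by simp⟩
  · have : (‖a‖ : ℂ) ≠ 0 := by simpa using h
    refine ⟨a / ‖a‖, ?_, by field_simp⟩
    rw [norm_div, Complex.norm_real, norm_norm, div_self (by simpa using h)]

/-- The far point of an Apollonius circle with foci `w` and `1`. -/
lemma exists_one_le_norm_of_le {k : ℝ} (hk0 : 0 ≤ k) (hk1 : k < 1) {w : ℂ}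
    (h : 2 * (1 - w.re) ≤ ‖w - 1‖ ^ 2 + 2 * k * ‖w - 1‖) :
    ∃ z : ℂ, 1 ≤ ‖z‖ ∧ ‖w - z‖ = k * ‖z - 1‖ := by
  set ρ := ‖w - 1‖ with hρ
  have hρ0 : 0 ≤ ρ := norm_nonneg _
  have hρ2 := sq_norm_sub_one w
  rw [← hρ] at hρ2
  obtain ⟨e, he1, he⟩ := exists_norm_eq_one_mul (w - (k ^ 2 : ℝ))
  set α := ‖w - (k ^ 2 : ℝ)‖ with hα
  have hα0 : 0 ≤ α := norm_nonneg _
  have hD : 0 < 1 - k ^ 2 := by nlinarith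
  have hre : w.re = k ^ 2 + α * e.re := by
    have := congrArg Complex.re he; simp [-Complex.ofReal_pow] at this; linarith
  have him : w.im = α * e.im := by
    have := congrArg Complex.im he; simp [-Complex.ofReal_pow] at this; linarith
  have hpq : e.re ^ 2 + e.im ^ 2 = 1 := by rw [← sq_norm_eq, he1, one_pow]
  have hα2 : α ^ 2 = ρ ^ 2 - 2 * (1 - k ^ 2) * (1 - w.re) + (1 - k ^ 2) ^ 2 := by
    rw [hρ2, hre, him]; linear_combination -α ^ 2 * hpq
  -- The circle `|w - z| = k |z - 1|` has centre `(w - k²) / (1 - k²)` and radius `kρ / (1 - k²)`;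
  -- `N` is the largest modulus on it, attained at `N e`.
  set N := (α + k * ρ) / (1 - k ^ 2) with hN
  have hN0 : 0 ≤ N := by positivity
  have hND : N * (1 - k ^ 2) = α + k * ρ := div_mul_cancel₀ _ hD.ne'
  refine ⟨N * e, ?_, ?_⟩
  · rw [norm_mul, he1, Complex.norm_real, Real.norm_eq_abs, abs_of_nonneg hN0, mul_one, hN,
      one_le_div hD]
    have : 1 - k ^ 2 - k * ρ ≤ α := by
      refine abs_le_of_sq_le_sq' ?_ hα0 |>.2
      rw [hα2]
      nlinarith
    linarith
  · have hkz : 0 ≤ k * ‖(N : ℂ) * e - 1‖ := by positivity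
    rw [← abs_of_nonneg (norm_nonneg (w - N * e)), ← abs_of_nonneg hkz, ← sq_eq_sq_iff_abs_eq_abs,
      mul_pow, sq_norm_sub_one, sq_norm_eq]
    have e1 : (w - N * e).re = w.re - N * e.re := by simp
    have e2 : (w - N * e).im = w.im - N * e.im := by simp
    have e3 : ((N : ℂ) * e).re = N * e.re := by simp
    have e4 : ((N : ℂ) * e).im = N * e.im := by simp
    rw [e1, e2, e3, e4]
    have hN' : (1 - k ^ 2) * N ^ 2 - 2 * N * α + (w.re ^ 2 + w.im ^ 2) - k ^ 2 = 0 := by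
      refine (mul_eq_zero.1 (?_ : (1 - k ^ 2) * ((1 - k ^ 2) * N ^ 2 - 2 * N * α
        + (w.re ^ 2 + w.im ^ 2) - k ^ 2) = 0)).resolve_left hD.ne'
      have : (1 - k ^ 2) ^ 2 * N ^ 2 = (α + k * ρ) ^ 2 := by rw [← hND]; ring
      linear_combination this - 2 * α * hND - hα2 - (1 - k ^ 2) * hρ2
    rw [← sub_eq_zero, ← hN', hre, him]
    linear_combination (N ^ 2 - k ^ 2 * N ^ 2 - 2 * N * α) * hpq

/-- Scaling `z` by `1 + ε` moves it off the unit circle, and the gap between `k` and `k'` absorbs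
the displacement; `w ≠ 1` excludes `z = 1`, where there would be no gap. -/
lemma exists_one_lt_norm_of_le {k k' : ℝ} (hk0 : 0 ≤ k) (hk1 : k < 1) (hkk' : k < k') {w : ℂ}
    (hw : w ≠ 1) (h : 2 * (1 - w.re) ≤ ‖w - 1‖ ^ 2 + 2 * k * ‖w - 1‖) :
    ∃ z : ℂ, 1 < ‖z‖ ∧ ‖w - z‖ ≤ k' * ‖z - 1‖ := by
  obtain ⟨z, hz, hzw⟩ := exists_one_le_norm_of_le hk0 hk1 h
  have hz1 : z ≠ 1 := by
    rintro rfl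
    simp only [sub_self, norm_zero, mul_zero, norm_eq_zero] at hzw
    exact hw (sub_eq_zero.1 hzw)
  have hlt : ‖w - ((1 + (0 : ℝ) : ℝ) : ℂ) * z‖ < k' * ‖((1 + (0 : ℝ) : ℝ) : ℂ) * z - 1‖ := by
    simp only [add_zero, Complex.ofReal_one, one_mul]
    rw [hzw]
    exact mul_lt_mul_of_pos_right hkk' (norm_pos_iff.2 (sub_ne_zero.2 hz1))
  have hcont : ∀ᶠ ε : ℝ in 𝓝 0,
      ‖w - ((1 + ε : ℝ) : ℂ) * z‖ < k' * ‖((1 + ε : ℝ) : ℂ) * z - 1‖ :=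
    ContinuousAt.eventually_lt (f := fun ε : ℝ => ‖w - ((1 + ε : ℝ) : ℂ) * z‖)
      (g := fun ε : ℝ => k' * ‖((1 + ε : ℝ) : ℂ) * z - 1‖) (by fun_prop) (by fun_prop) hlt
  obtain ⟨ε, hε, hε0⟩ := ((hcont.filter_mono nhdsWithin_le_nhds).and
    (self_mem_nhdsWithin : ∀ᶠ ε in 𝓝[>] (0 : ℝ), ε ∈ Ioi 0)).exists
  refine ⟨((1 + ε : ℝ) : ℂ) * z, ?_, hε.le⟩
  have hε0' : 0 < ε := hε0
  rw [norm_mul, Complex.norm_real, Real.norm_eq_abs, abs_of_pos (by linarith)]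
  nlinarith

lemma stolz_aux {α : ℝ} (h0 : 0 < Real.sin α) :
    ball (0 : ℂ) (Real.sin α) ⊆ stolz α ∧ closedStolz α ⊆ closure (stolz α) ∧
      closure (stolz α) = closure (convexHull ℝ ({1} ∪ ball (0 : ℂ) (Real.sin α))) := by
  have h1 : ball (0 : ℂ) (Real.sin α) ⊆ stolz α :=
    interior_maximal (subset_union_right.trans (subset_convexHull _ _)) isOpen_ball
  have h2 : closure (stolz α) = closure (convexHull ℝ ({1} ∪ ball (0 : ℂ) (Real.sin α))) :=
    (convex_convexHull ℝ _).closure_interior_eq_closure_of_nonempty_interior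
      ⟨0, h1 (mem_ball_self h0)⟩
  refine ⟨h1, ?_, h2⟩
  rw [h2]
  refine convexHull_min (union_subset ?_ ?_) (convex_convexHull ℝ _).closure
  · exact (subset_union_left.trans (subset_convexHull _ _)).trans subset_closure
  · rw [← closure_ball _ h0.ne']
    exact closure_mono (subset_union_right.trans (subset_convexHull _ _))

lemma isOpen_stolz (α : ℝ) : IsOpen (stolz α) := isOpen_interior

lemma convex_stolz (α : ℝ) : Convex ℝ (stolz α) := (convex_convexHull ℝ _).interior

lemma ball_subset_stolz {α : ℝ} (h0 : 0 < Real.sin α) : ball (0 : ℂ) (Real.sin α) ⊆ stolz α :=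
  (stolz_aux h0).1

lemma closedStolz_subset_closure {α : ℝ} (h0 : 0 < Real.sin α) :
    closedStolz α ⊆ closure (stolz α) := (stolz_aux h0).2.1

/-- The half-plane with outer normal `u` tangent to the disc of radius `sin α` contains the disc;
the condition on `u.re` says that it contains `1` as well. -/
lemma re_conj_mul_le_of_mem_closure_stolz {α : ℝ} (h0 : 0 < Real.sin α) {u w : ℂ} (hu : ‖u‖ = 1)
    (hus : u.re ≤ Real.sin α) (hw : w ∈ closure (stolz α)) :
    u.re * w.re + u.im * w.im ≤ Real.sin α := by
  rw [(stolz_aux h0).2.2] at hw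
  have hcl : IsClosed {w : ℂ | u.re * w.re + u.im * w.im ≤ Real.sin α} :=
    isClosed_le (by fun_prop) continuous_const
  refine closure_minimal (convexHull_min (union_subset ?_ ?_) ?_) hcl hw
  · rintro _ rfl; simpa using hus
  · intro v hv
    rw [mem_ball_zero_iff] at hv
    have h1 : u.re * v.re + u.im * v.im = (starRingEnd ℂ u * v).re := by simp
    have h2 := Complex.re_le_norm (starRingEnd ℂ u * v)
    rw [norm_mul, RCLike.norm_conj, hu, one_mul] at h2
    simp only [mem_ofPred_eq]; linarith
  · intro x hx y hy a b ha hb hab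
    simp only [mem_ofPred_eq, Complex.add_re, Complex.add_im, Complex.real_smul, Complex.mul_re,
      Complex.mul_im, Complex.ofReal_re, Complex.ofReal_im] at hx hy ⊢
    nlinarith

/-- Such a point is a combination of `1`, in the closure of `𝓑_η`, and an interior point with
positive weight. The exception `1` is what the ball `B_r(1)` in `Ω` takes care of. -/
lemma mem_stolz_of_mem_closedStolz {θ η : ℝ} (hθ : 0 ≤ Real.sin θ)
    (hθη : Real.sin θ < Real.sin η) {w : ℂ} (hw : w ∈ closedStolz θ) (hw1 : w ≠ 1) :
    w ∈ stolz η := by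
  obtain ⟨t, ht, v, hv, rfl⟩ := (mem_closedStolz_iff hθ).1 hw
  have h0 : 0 < Real.sin η := hθ.trans_lt hθη
  have hv' : v ∈ stolz η := ball_subset_stolz h0 (closedBall_subset_ball hθη hv)
  have ht0 : 0 < t := by
    refine lt_of_le_of_ne ht.1 fun h => hw1 ?_
    rw [← h]; simp
  rw [add_comm]
  exact (convex_convexHull ℝ _).combo_interior_closure_mem_interior hv'
    (subset_closure (subset_convexHull _ _ (by simp))) ht0 (by linarith [ht.2]) (by ring)

lemma one_mem_closure_stolz {α : ℝ} (h0 : 0 < Real.sin α) : (1 : ℂ) ∈ closure (stolz α) :=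
  closedStolz_subset_closure h0 (one_mem_closedStolz α)

/-- Any displacement of `z` along `u` leaves the supporting half-plane, so `z` is a limit of
exterior points. The open set `𝓑_η` then misses `z`, and with it the smaller hull. -/
lemma notMem_closedStolz_of_halfPlane {θ η : ℝ} (hθ : 0 ≤ Real.sin θ)
    (hθη : Real.sin θ < Real.sin η) {u z : ℂ} (hu : ‖u‖ = 1) (hus : u.re ≤ Real.sin η)
    (hz1 : z ≠ 1) (hz : Real.sin η ≤ u.re * z.re + u.im * z.im) :
    z ∉ closedStolz θ ∧ z ∈ closure (closure (stolz η))ᶜ := by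
  have h0 : 0 < Real.sin η := hθ.trans_lt hθη
  have hout : ∀ ε : ℝ, 0 < ε → z + ε * u ∈ (closure (stolz η))ᶜ := by
    intro ε hε h
    have := re_conj_mul_le_of_mem_closure_stolz h0 hu hus h
    simp at this
    have h2 : u.re ^ 2 + u.im ^ 2 = 1 := by rw [← sq_norm_eq, hu, one_pow]
    nlinarith
  have htend : Tendsto (fun ε : ℝ => z + ε * u) (𝓝[>] 0) (𝓝 z) := by
    have : Continuous fun ε : ℝ => z + ε * u := by fun_prop
    have h := this.tendsto 0
    simp only [Complex.ofReal_zero, zero_mul, add_zero] at h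
    exact h.mono_left nhdsWithin_le_nhds
  have hcl : z ∈ closure (closure (stolz η))ᶜ :=
    mem_closure_of_tendsto htend (by filter_upwards [self_mem_nhdsWithin] with ε hε using hout ε hε)
  refine ⟨fun h => ?_, hcl⟩
  have hzs := mem_stolz_of_mem_closedStolz hθ hθη h hz1
  obtain ⟨w, hw, hw'⟩ := mem_closure_iff.1 hcl _ (isOpen_stolz η) hzs
  exact hw' (subset_closure hw)

end Geometry

/-! ### Resolvent bounds for Tadmor--Ritt operators. -/

section Resolvent

variable {X : Type*} [NormedAddCommGroup X] [NormedSpace ℂ X] {T : X →L[ℂ] X}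

lemma rittConst_nonneg (T : X →L[ℂ] X) : 0 ≤ rittConst T := by
  refine Real.sSup_nonneg ?_
  rintro _ ⟨z, _, rfl⟩; exact norm_nonneg _

lemma IsTadmorRitt.norm_le (hT : IsTadmorRitt T) {z : ℂ} (hz : 1 < ‖z‖) :
    ‖(z - 1) • resolvent T z‖ ≤ rittConst T :=
  le_csSup hT.bddAbove ⟨z, hz, rfl⟩

lemma IsTadmorRitt.mem_resolventSet (hT : IsTadmorRitt T) {z : ℂ} (hz : 1 < ‖z‖) :
    z ∈ resolventSet ℂ T := by
  by_contra h
  have := hT.spectrum_subset h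
  rw [mem_closedBall_zero_iff] at this
  linarith

/-- The only relation between `θ` and `C(T)` needed later. As an inequality it also survives `C(T) =
0` and the truncation of `arccos` above `1`, so `C(T) ≥ 1` need not be known. -/
lemma cos_arccos_mul_rittConst_le (T : X →L[ℂ] X) :
    Real.cos (Real.arccos (1 / rittConst T)) * rittConst T ≤ 1 := by
  rcases (rittConst_nonneg T).eq_or_lt with h | h
  · rw [← h]; simp
  have hle : Real.cos (Real.arccos (1 / rittConst T)) ≤ 1 / rittConst T := by
    rcases le_total (1 / rittConst T) 1 with h1 | h1
    · rw [Real.cos_arccos (by linarith [show 0 < 1 / rittConst T by positivity]) h1]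
    · rw [Real.arccos_of_one_le h1, Real.cos_zero]; exact h1
  rwa [le_div_iff₀ h] at hle

variable [CompleteSpace X]

/-- Perturbation of the resolvent from a point `z` outside the disc to a point `w` with
`|w - z| ≤ k |z - 1|`. -/
lemma IsTadmorRitt.resolvent_perturb (hT : IsTadmorRitt T) {k : ℝ} (hk : 0 ≤ k)
    (hkC : k * rittConst T < 1) {z w : ℂ} (hz : 1 < ‖z‖) (hzw : ‖w - z‖ ≤ k * ‖z - 1‖) :
    w ∈ resolventSet ℂ T ∧
      ‖(w - 1) • resolvent T w‖ ≤ (1 + k) * rittConst T / (1 - k * rittConst T) := by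
  set C := rittConst T with hC
  have hzr := hT.mem_resolventSet hz
  have hb : ‖z - 1‖ * ‖resolvent T z‖ ≤ C := by
    rw [← norm_smul]; exact hT.norm_le hz
  have hq : ‖(z - w) • resolvent T z‖ ≤ k * C := by
    rw [norm_smul, norm_sub_rev]
    calc ‖w - z‖ * ‖resolvent T z‖ ≤ k * ‖z - 1‖ * ‖resolvent T z‖ := by gcongr
      _ = k * (‖z - 1‖ * ‖resolvent T z‖) := by ring
      _ ≤ k * C := by gcongr
  have hw : w ∈ resolventSet ℂ T := by
    rw [spectrum.mem_resolventSet_iff]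
    -- Factorisation `w - T = (z - T)(1 - (z - w) R(z, T))`.
    have hu := (spectrum.mem_resolventSet_iff.1 hzr).mul
      (isUnit_one_sub_of_norm_lt_one (hq.trans_lt hkC))
    convert! hu using 1
    rw [mul_sub, mul_one, mul_smul_comm, sub_mul_resolvent hzr, ← Algebra.algebraMap_eq_smul_one,
      map_sub]
    abel
  refine ⟨hw, ?_⟩
  have hid := resolvent_identity hw hzr
  have h1 : ‖resolvent T w‖ ≤ ‖resolvent T z‖ + k * C * ‖resolvent T w‖ := by
    have e : resolvent T w = resolvent T z + (z - w) • (resolvent T z * resolvent T w) := by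
      have : (z - w) • (resolvent T z * resolvent T w) =
          -((w - z) • (resolvent T z * resolvent T w)) := by rw [← neg_smul, neg_sub]
      rw [this, ← hid]; abel
    calc ‖resolvent T w‖ ≤ ‖resolvent T z‖ + ‖(z - w) • (resolvent T z * resolvent T w)‖ := by
          conv_lhs => rw [e]
          exact norm_add_le _ _
      _ ≤ _ := by
          rw [← smul_mul_assoc]
          gcongr
          exact (norm_mul_le _ _).trans (by gcongr)
  rw [norm_smul, le_div_iff₀ (by linarith)]
  have h2 : ‖w - 1‖ ≤ (1 + k) * ‖z - 1‖ := by
    calc ‖w - 1‖ = ‖(w - z) + (z - 1)‖ := by congr 1; ring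
      _ ≤ ‖w - z‖ + ‖z - 1‖ := norm_add_le _ _
      _ ≤ _ := by linarith
  calc ‖w - 1‖ * ‖resolvent T w‖ * (1 - k * C)
      = ‖w - 1‖ * (‖resolvent T w‖ * (1 - k * C)) := by ring
    _ ≤ ‖w - 1‖ * ‖resolvent T z‖ := by gcongr; linarith
    _ ≤ (1 + k) * ‖z - 1‖ * ‖resolvent T z‖ := by gcongr
    _ = (1 + k) * (‖z - 1‖ * ‖resolvent T z‖) := by ring
    _ ≤ (1 + k) * C := by gcongr

theorem IsTadmorRitt.spectrum_subset_closedStolz (hT : IsTadmorRitt T) {θ : ℝ}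
    (hs : 0 ≤ Real.sin θ) (hk : 0 < Real.cos θ) (hθ : Real.cos θ * rittConst T ≤ 1) :
    spectrum ℂ T ⊆ closedStolz θ := by
  intro w hw
  by_contra hwK
  have hw1 : w ≠ 1 := fun h => hwK (h ▸ one_mem_closedStolz θ)
  have hρ : 0 < ‖w - 1‖ := norm_pos_iff.2 (sub_ne_zero.2 hw1)
  have hlt : 2 * (1 - w.re) < ‖w - 1‖ ^ 2 + 2 * Real.cos θ * ‖w - 1‖ :=
    not_le.1 fun h => hwK (mem_closedStolz_of_le hs hk.le h)
  -- `q` is the parameter of the limaçon through `w`. Since `q < cos θ`, there is room for `k₁ < k₂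
  -- < cos θ`: `k₁` for the Apollonius circle, `k₂` for pushing `z` outside the unit disc while
  -- keeping `k₂ C(T) < 1`.
  set q := (2 * (1 - w.re) - ‖w - 1‖ ^ 2) / (2 * ‖w - 1‖) with hq
  have hqk : q < Real.cos θ := by rw [hq, div_lt_iff₀ (by positivity)]; linarith
  obtain ⟨k₁, h1, h2⟩ := exists_between (max_lt hqk hk)
  obtain ⟨k₂, h3, h4⟩ := exists_between h2
  have hk₁ : 0 ≤ k₁ := (le_max_right _ _).trans h1.le
  have hq1 : q ≤ k₁ := (le_max_left _ _).trans h1.le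
  rw [hq, div_le_iff₀ (by positivity)] at hq1
  obtain ⟨z, hz, hzw⟩ := exists_one_lt_norm_of_le hk₁ (h2.trans_le (Real.cos_le_one θ)) h3 hw1
    (by linarith)
  refine hw (hT.resolvent_perturb (hk₁.trans h3.le) ?_ hz hzw).1
  rcases (rittConst_nonneg T).eq_or_lt with h | h
  · rw [← h]; simp
  · exact (mul_lt_mul_of_pos_right h4 h).trans_le hθ

theorem IsTadmorRitt.bddAbove_sectorValues (hT : IsTadmorRitt T) {η : ℝ}
    (hs : 0 < Real.sin η) (hk : 0 ≤ Real.cos η) (hk1 : Real.cos η < 1)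
    (hη : Real.cos η * rittConst T < 1) : BddAbove (sectorValues T η) := by
  have hC := rittConst_nonneg T
  obtain ⟨k', hk', hk'C⟩ : ∃ k', Real.cos η < k' ∧ k' * rittConst T < 1 := by
    have : ∀ᶠ x in 𝓝 (Real.cos η), x * rittConst T < 1 :=
      ContinuousAt.eventually_lt (by fun_prop) (by fun_prop) hη
    obtain ⟨x, hx, hx'⟩ := ((this.filter_mono nhdsWithin_le_nhds).and
      (self_mem_nhdsWithin : ∀ᶠ x in 𝓝[>] (Real.cos η), x ∈ Ioi (Real.cos η))).exists
    exact ⟨x, hx', hx⟩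
  refine ⟨(1 + k') * rittConst T / (1 - k' * rittConst T), ?_⟩
  rintro _ ⟨w, hw, rfl⟩
  have hwK : w ∉ closedStolz η := fun h => hw (closedStolz_subset_closure hs h)
  have hw1 : w ≠ 1 := fun h => hwK (h ▸ one_mem_closedStolz η)
  obtain ⟨z, hz, hzw⟩ := exists_one_lt_norm_of_le hk hk1 hk' hw1
    (not_le.1 fun h => hwK (mem_closedStolz_of_le hs.le hk h)).le
  exact (hT.resolvent_perturb (hk.trans hk'.le) hk'C hz hzw).2

/-- On the closure of the complement of the closed Stolz domain, `‖R(z, T)‖ ≤ C_η(T) / |z - 1|`. -/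
theorem norm_resolvent_le_of_mem_closure {η : ℝ} (hb : BddAbove (sectorValues T η)) {z : ℂ}
    (hz : z ∈ resolventSet ℂ T) (hz1 : z ≠ 1) (hzc : z ∈ closure (closure (stolz η))ᶜ) :
    ‖resolvent T z‖ ≤ sectorConst T η / ‖z - 1‖ := by
  rw [le_div_iff₀ (norm_pos_iff.2 (sub_ne_zero.2 hz1)), mul_comm, ← norm_smul]
  have hc : ContinuousAt (fun w => ‖(w - 1) • resolvent T w‖) z :=
    ((continuousAt_id.sub continuousAt_const).smul
      (spectrum.hasDerivAt_resolvent_const_left hz).continuousAt).norm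
  have hne : (𝓝[(closure (stolz η))ᶜ] z).NeBot := mem_closure_iff_nhdsWithin_neBot.1 hzc
  refine le_of_tendsto (hc.tendsto.mono_left nhdsWithin_le_nhds :
    Tendsto _ (𝓝[(closure (stolz η))ᶜ] z) _) ?_
  filter_upwards [self_mem_nhdsWithin] with w hw
  exact le_csSup hb ⟨w, hw, rfl⟩

end Resolvent

/-! ### Existence of contours around compact convex sets. -/

section Existence

/-- The parametrization `t ↦ exp (2πit)` of the unit circle. -/
def unitCurve (t : ℝ) : ℂ := Complex.exp (2 * Real.pi * Complex.I * t)

lemma norm_unitCurve (t : ℝ) : ‖unitCurve t‖ = 1 := by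
  rw [unitCurve, show 2 * (Real.pi : ℂ) * Complex.I * t = (2 * Real.pi * t : ℝ) * Complex.I by
    push_cast; ring, Complex.norm_exp_ofReal_mul_I]

lemma hasDerivAt_unitCurve (t : ℝ) :
    HasDerivAt unitCurve (2 * Real.pi * Complex.I * unitCurve t) t := by
  have h := ((Complex.ofRealCLM.hasDerivAt (x := t)).const_mul (2 * (Real.pi : ℂ) * Complex.I)).cexp
  convert! h using 1
  simp [unitCurve]; ring

lemma dist_unitCurve_le (x y : ℝ) : ‖unitCurve x - unitCurve y‖ ≤ 2 * Real.pi * |x - y| := by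
  have := Convex.norm_image_sub_le_of_norm_hasDerivWithin_le (f := unitCurve)
    (C := 2 * Real.pi) (s := univ) (x := y) (y := x)
    (fun t _ => (hasDerivAt_unitCurve t).hasDerivWithinAt) (fun t _ => by
      simp [norm_unitCurve, abs_of_pos Real.pi_pos]) convex_univ (mem_univ _) (mem_univ _)
  simpa using this

lemma unitCurve_injOn : InjOn unitCurve (Ico 0 1) := by
  intro x hx y hy h
  obtain ⟨n, hn⟩ := Complex.exp_eq_exp_iff_exists_int.1 h
  have h1 : (x : ℂ) = y + n := by
    have h2 : (2 * (Real.pi : ℂ) * Complex.I) * x = (2 * (Real.pi : ℂ) * Complex.I) * (y + n) := by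
      rw [hn]; ring
    exact mul_left_cancel₀ Complex.two_pi_I_ne_zero h2
  have h2 : x = y + n := by exact_mod_cast h1
  have h3 : (-1 : ℝ) < n := by linarith [hx.1, hy.2]
  have h4 : (n : ℝ) < 1 := by linarith [hx.2, hy.1]
  have h5 : n = 0 := by
    have : (-1 : ℤ) < n := by exact_mod_cast h3
    have : n < (1 : ℤ) := by exact_mod_cast h4
    omega
  rw [h2, h5]; simp

/-- A closed curve avoiding a compact set `K`, star-shaped about `1`, has the same winding number
about every point of `K`. -/
lemma contourIntegral_inv_sub_eq {K : Set ℂ} (hK : IsCompact K) (hK1 : StarConvex ℝ 1 K)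
    (h1 : (1 : ℂ) ∈ K) {γ : ℝ → ℂ} {L : NNReal} (hL : LipschitzOnWith L γ (Icc 0 1))
    (hcl : γ 0 = γ 1) (hav : ∀ t ∈ Icc (0 : ℝ) 1, γ t ∉ K) {w : ℂ} (hw : w ∈ K) :
    contourIntegral γ (fun z => (z - w)⁻¹) = contourIntegral γ (fun z => (z - 1)⁻¹) := by
  -- Applied in the algebra `ℂ`, where the element `w` has spectrum `{w}` and resolvent `(z - w)⁻¹`.
  obtain ⟨P, hP⟩ := exists_primitive_resolvent_sub (a := w) hK hK1 h1 (by
    intro v hv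
    have : v = w := by
      by_contra hne
      refine hv (spectrum.mem_resolventSet_iff.2 ?_)
      simpa using sub_ne_zero.2 hne
    rwa [this])
  have h0 := contourIntegral_eq_zero_of_closed hL hcl hK.isClosed.isOpen_compl hav hP
  have hi : ∀ v ∈ K, IntervalIntegrable (fun t => deriv γ t • (γ t - v)⁻¹) volume 0 1 :=
    fun v hv => intervalIntegrable_deriv_smul hL (ContinuousOn.inv₀
      (hL.continuousOn.sub continuousOn_const)
      fun t ht h => hav t ht (by rwa [sub_eq_zero.1 h]))
  rw [← sub_eq_zero, ← h0]
  simp only [contourIntegral]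
  rw [← intervalIntegral.integral_sub (hi w hw) (hi 1 h1)]
  congr 1; ext t
  simp [resolvent]; ring

/-- Around a compact convex set inside an open set there is a contour inside the open set. -/
theorem exists_isContourAround {K Ω : Set ℂ} (hK : IsCompact K) (hKc : Convex ℝ K)
    (h1 : (1 : ℂ) ∈ K) (hΩ : IsOpen Ω) (hKΩ : K ⊆ Ω) : ∃ γ : ℝ → ℂ, IsContourAround K Ω γ := by
  obtain ⟨δ, hδ, hδΩ⟩ := hK.exists_cthickening_subset_open hΩ hKΩ
  set U : Set ℂ := (fun v => 1 + v) ⁻¹' thickening δ K with hU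
  have hUo : IsOpen U := isOpen_thickening.preimage (by fun_prop)
  have hUc : Convex ℝ U := (hKc.thickening δ).translate_preimage_right 1
  have hU0 : (0 : ℂ) ∈ U := by simpa [hU] using self_subset_thickening hδ K h1
  have hUn : U ∈ 𝓝 0 := hUo.mem_nhds hU0
  have habs : Absorbent ℝ U := absorbent_nhds_zero hUn
  obtain ⟨R, hR0, hR⟩ : ∃ R, 0 < R ∧ U ⊆ closedBall 0 R := by
    obtain ⟨R, hR⟩ := (hK.isBounded.thickening (δ := δ)).subset_closedBall 1
    refine ⟨max R 1, by positivity, fun v hv => ?_⟩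
    have := hR hv
    rw [mem_closedBall, dist_eq_norm, add_sub_cancel_left] at this
    rw [mem_closedBall_zero_iff]; exact this.trans (le_max_left _ _)
  -- The contour is the boundary of a thickening of `K` in polar coordinates about `1`, with radius
  -- the inverse of the gauge. Convexity makes the gauge Lipschitz, and boundedness keeps it away
  -- from `0`.
  set G : ℝ → ℝ := fun t => gauge U (unitCurve t) with hG
  have hGR : ∀ t, R⁻¹ ≤ G t := fun t => by
    have := le_gauge_of_subset_closedBall habs hR0.le hR (x := unitCurve t)
    rwa [norm_unitCurve, one_div] at this
  have hG0 : ∀ t, 0 < G t := fun t => (inv_pos.2 hR0).trans_le (hGR t)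
  obtain ⟨M, hM⟩ := hUc.lipschitz_gauge hUn
  set ρ : ℝ → ℝ := fun t => (G t)⁻¹ with hρ
  have hρ0 : ∀ t, 0 < ρ t := fun t => inv_pos.2 (hG0 t)
  have hρR : ∀ t, ρ t ≤ R := fun t => (inv_le_comm₀ (hG0 t) hR0).2 (hGR t)
  have hρL : ∀ x y, |ρ x - ρ y| ≤ R * R * (M * (2 * Real.pi)) * |x - y| := by
    intro x y
    have e : ρ x - ρ y = ρ x * ρ y * (G y - G x) := by
      simp only [hρ]; field_simp [(hG0 x).ne', (hG0 y).ne']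
    have h2 : |G y - G x| ≤ M * (2 * Real.pi * |x - y|) := by
      have := hM.dist_le_mul (unitCurve y) (unitCurve x)
      rw [Real.dist_eq, dist_eq_norm] at this
      refine this.trans ?_
      rw [abs_sub_comm x y]
      exact mul_le_mul_of_nonneg_left (dist_unitCurve_le y x) M.2
    rw [e, abs_mul, abs_of_pos (mul_pos (hρ0 x) (hρ0 y))]
    calc ρ x * ρ y * |G y - G x| ≤ R * R * (M * (2 * Real.pi * |x - y|)) := by
          gcongr
          · exact (hρ0 y).le
          · exact hρR x
          · exact hρR y
      _ = _ := by ring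
  set γ : ℝ → ℂ := fun t => 1 + ρ t * unitCurve t with hγ
  have hnorm : ∀ t, ‖γ t - 1‖ = ρ t := fun t => by
    simp [hγ, norm_unitCurve, abs_of_pos (hρ0 t)]
  have hgauge : ∀ t, gauge U (γ t - 1) = 1 := fun t => by
    have : γ t - 1 = ρ t • unitCurve t := by simp [hγ]
    rw [this, gauge_smul_of_nonneg (hρ0 t).le, smul_eq_mul]
    exact inv_mul_cancel₀ (hG0 t).ne'
  have hρlip : LipschitzWith (R * R * (M * (2 * Real.pi))).toNNReal (fun t => (ρ t : ℂ)) := by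
    refine LipschitzWith.of_dist_le_mul fun x y => ?_
    rw [Complex.dist_eq, ← Complex.ofReal_sub, Complex.norm_real, Real.coe_toNNReal _ (by positivity)]
    exact hρL x y
  have hlip : LipschitzWith (R * R * (M * (2 * Real.pi)) + R * (2 * Real.pi)).toNNReal γ := by
    refine LipschitzWith.of_dist_le_mul fun x y => ?_
    rw [Complex.dist_eq, Real.coe_toNNReal _ (by positivity), Real.dist_eq]
    have e : γ x - γ y = ((ρ x - ρ y : ℝ) : ℂ) * unitCurve x
        + ρ y * (unitCurve x - unitCurve y) := by simp only [hγ]; push_cast; ring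
    rw [e]
    refine (norm_add_le _ _).trans ?_
    rw [norm_mul, norm_mul, norm_unitCurve, Complex.norm_real, Complex.norm_real, Real.norm_eq_abs,
      Real.norm_eq_abs, abs_of_pos (hρ0 y), mul_one, add_mul, mul_assoc R (2 * Real.pi)]
    gcongr
    · exact hρL x y
    · exact hρR y
    · exact dist_unitCurve_le x y
  have hclosed : γ 0 = γ 1 := by
    have : unitCurve 0 = unitCurve 1 := by simp [unitCurve]
    simp only [hγ, hρ, hG, this]
  have havoid : ∀ t ∈ Icc (0 : ℝ) 1, γ t ∉ K := fun t _ h => by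
    have hm : γ t - 1 ∈ U := by
      simp only [hU, mem_preimage, add_sub_cancel]
      exact self_subset_thickening hδ K h
    exact (gauge_lt_one_of_mem_of_isOpen hUo hm).ne (hgauge t)
  -- The logarithmic derivative of `γ - 1` is `ρ'/ρ + 2πi`, and `log ρ` takes equal values at the
  -- two ends.
  have hwind : contourIntegral γ (fun z => (z - 1)⁻¹) = 2 * (Real.pi : ℂ) * Complex.I := by
    have hlog : contourIntegral (fun t => (ρ t : ℂ)) (fun z => z⁻¹) = 0 := by
      refine contourIntegral_eq_zero_of_closed (hρlip.lipschitzOnWith) ?_ Complex.isOpen_slitPlane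
        (fun t _ => ?_) (P := Complex.log) fun z hz => Complex.hasDerivAt_log hz
      · have : unitCurve 0 = unitCurve 1 := by simp [unitCurve]
        simp only [hρ, hG, this]
      · exact Complex.ofReal_mem_slitPlane.2 (hρ0 t)
    have hint : IntervalIntegrable (fun t => deriv (fun t => (ρ t : ℂ)) t • (ρ t : ℂ)⁻¹)
        volume 0 1 :=
      intervalIntegrable_deriv_smul hρlip.lipschitzOnWith
        (ContinuousOn.inv₀ hρlip.continuous.continuousOn
          fun t _ => by exact_mod_cast (hρ0 t).ne')
    have hae : ∀ᵐ t : ℝ, t ∈ uIoc (0 : ℝ) 1 → deriv γ t • (γ t - 1)⁻¹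
        = deriv (fun t => (ρ t : ℂ)) t • (ρ t : ℂ)⁻¹ + 2 * Real.pi * Complex.I := by
      filter_upwards [hρlip.ae_differentiableAt_real] with t ht _
      have hd := (ht.hasDerivAt.mul (hasDerivAt_unitCurve t)).const_add 1
      have hd' : deriv γ t = deriv (fun t => (ρ t : ℂ)) t * unitCurve t
        + ρ t * (2 * Real.pi * Complex.I * unitCurve t) := hd.deriv
      have n1 : (ρ t : ℂ) ≠ 0 := by exact_mod_cast (hρ0 t).ne'
      have n2 : unitCurve t ≠ 0 := Complex.exp_ne_zero _
      rw [hd']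
      simp only [hγ, add_sub_cancel_left, smul_eq_mul]
      field_simp
    rw [contourIntegral, intervalIntegral.integral_congr_ae hae,
      intervalIntegral.integral_add hint (by simp)]
    rw [contourIntegral] at hlog
    rw [hlog]; simp
  refine ⟨γ, ⟨_, hlip.lipschitzOnWith⟩, hclosed, ?_, ?_, havoid, ?_⟩
  · intro x hx y hy hxy
    refine unitCurve_injOn hx hy ?_
    have e1 : ρ x = ρ y := by rw [← hnorm x, ← hnorm y, hxy]
    have n1 : (ρ y : ℂ) ≠ 0 := by exact_mod_cast (hρ0 y).ne'
    simp only [hγ, e1] at hxy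
    exact mul_left_cancel₀ n1 (add_left_cancel hxy)
  · intro t _
    have hc : γ t - 1 ∈ closure U := (gauge_le_one_iff_mem_closure hUc hUn).1 (hgauge t).le
    have hc' : 1 + (γ t - 1) ∈ closure (thickening δ K) :=
      (by fun_prop : Continuous fun v : ℂ => 1 + v).closure_preimage_subset (thickening δ K) hc
    rw [add_sub_cancel] at hc'
    exact hδΩ (closure_thickening_subset_cthickening δ K hc')
  · intro w hw
    rw [contourIntegral_inv_sub_eq hK (hKc h1) h1 hlip.lipschitzOnWith hclosed havoid hw, hwind]
    exact inv_mul_cancel₀ Complex.two_pi_I_ne_zero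

end Existence

/-! ### Real integrals behind the constant `𝒞(r, m, η)`. -/

section RealEstimates

lemma integrableOn_exp_neg_div {c : ℝ} (hc : 0 < c) :
    IntegrableOn (fun x => Real.exp (-x) / x) (Ioi c) := by
  have h1 : IntegrableOn (fun x => c⁻¹ * Real.exp (-1 * x)) (Ioi c) :=
    (exp_neg_integrableOn_Ioi c one_pos).const_mul _
  refine h1.mono' ?_ ?_
  · refine ContinuousOn.aestronglyMeasurable ?_ measurableSet_Ioi
    exact ContinuousOn.div (by fun_prop) continuousOn_id fun _ hx => (hc.trans hx).ne'
  · refine (ae_restrict_iff' measurableSet_Ioi).2 (Eventually.of_forall fun x hx => ?_)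
    have hx0 : 0 < x := hc.trans hx
    rw [Real.norm_eq_abs, abs_of_pos (by positivity), div_eq_inv_mul, neg_one_mul]
    gcongr
    exact (mem_Ioi.1 hx).le

lemma Ei_nonneg {c : ℝ} (hc : 0 < c) : 0 ≤ Ei c :=
  setIntegral_nonneg measurableSet_Ioi fun _ hx =>
    div_nonneg (Real.exp_pos _).le (hc.trans hx).le

/-- Substitution `x = aρ`. The minimum makes the interval degenerate when `k ≤ r`, and then `Ei ≥ 0`
suffices. -/
lemma integral_exp_neg_mul_div_le {a r k : ℝ} (ha : 0 < a) (hr : 0 < r) :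
    ∫ ρ in (min r k)..k, Real.exp (-(a * ρ)) / ρ ≤ Ei (a * r) := by
  rcases le_total k r with h | h
  · rw [min_eq_right h, intervalIntegral.integral_same]
    exact Ei_nonneg (by positivity)
  rw [min_eq_left h]
  have e : ∀ ρ ∈ uIcc r k, Real.exp (-(a * ρ)) / ρ
      = a * (fun x => Real.exp (-x) / x) (a * ρ) := by
    intro ρ hρ
    rw [uIcc_of_le h] at hρ
    have : 0 < ρ := hr.trans_le hρ.1
    field_simp
  rw [intervalIntegral.integral_congr e, intervalIntegral.integral_const_mul,
    intervalIntegral.integral_comp_mul_left (fun x => Real.exp (-x) / x) ha.ne', smul_eq_mul,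
    mul_inv_cancel_left₀ ha.ne', intervalIntegral.integral_of_le (by gcongr)]
  have hc : 0 < a * r := by positivity
  refine setIntegral_mono_set (integrableOn_exp_neg_div hc) ?_ Ioc_subset_Ioi_self.eventuallyLE
  refine (ae_restrict_iff' measurableSet_Ioi).2 (Eventually.of_forall fun x hx => ?_)
  exact div_nonneg (Real.exp_pos _).le (hc.trans hx).le

/-- From `ρ ≤ k`, `|z|² ≤ 1 - ρk ≤ e^{-ρk}`. Replacing `m` by `m + 1` in the exponent costs
`e^{ρk/2} ≤ 2`; with two rays this makes the factor `4` before `Ei`. -/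
lemma norm_ray_pow_le {k ρ : ℝ} (hk1 : k ≤ 1) (hρ : 0 ≤ ρ) (hρk : ρ ≤ k) (m : ℕ)
    {z : ℂ} (hz : ‖z‖ ^ 2 = 1 - 2 * ρ * k + ρ ^ 2) :
    ‖z‖ ^ m ≤ 2 * Real.exp (-((((m : ℝ) + 1) / 2 * k) * ρ)) := by
  have h1 : ‖z‖ ≤ Real.exp (-(ρ * k / 2)) := by
    refine abs_le_of_sq_le_sq' ?_ (Real.exp_pos _).le |>.2
    rw [hz, ← Real.exp_nat_mul]
    have := Real.add_one_le_exp (-(ρ * k))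
    have e : ((2 : ℕ) : ℝ) * -(ρ * k / 2) = -(ρ * k) := by push_cast; ring
    rw [e]
    nlinarith
  have h2 : Real.exp (ρ * k / 2) ≤ 2 := by
    have h3 : ρ * k / 2 ≤ Real.log 2 := by
      have := Real.log_two_gt_d9
      nlinarith
    calc Real.exp (ρ * k / 2) ≤ Real.exp (Real.log 2) := Real.exp_le_exp.2 h3
      _ = 2 := Real.exp_log (by norm_num)
  calc ‖z‖ ^ m ≤ Real.exp (-(ρ * k / 2)) ^ m := by gcongr
    _ = Real.exp (ρ * k / 2) * Real.exp (-((((m : ℝ) + 1) / 2 * k) * ρ)) := by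
        rw [← Real.exp_nat_mul, ← Real.exp_add]; congr 1; ring
    _ ≤ _ := by gcongr

lemma hasDerivAt_log_sin_sub_log_one_add_cos {φ : ℝ} (h : 0 < Real.sin φ) :
    HasDerivAt (fun x => Real.log (Real.sin x) - Real.log (1 + Real.cos x)) (1 / Real.sin φ) φ := by
  have hc : 0 < 1 + Real.cos φ := by
    nlinarith [Real.sin_sq_add_cos_sq φ, Real.neg_one_le_cos φ, Real.cos_le_one φ, sq_pos_of_pos h]
  have := ((Real.hasDerivAt_sin φ).log h.ne').sub
    (((Real.hasDerivAt_cos φ).const_add 1).log hc.ne')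
  convert! this using 1
  field_simp
  linear_combination -Real.sin_sq_add_cos_sq φ

/-- After multiplication by `e^{-iφ}` the imaginary part is `-sin φ`. -/
lemma sin_le_norm_one_add (s φ : ℝ) :
    Real.sin φ ≤ ‖1 + s * Complex.exp (φ * Complex.I)‖ := by
  refine abs_le_of_sq_le_sq' ?_ (norm_nonneg _) |>.2
  rw [sq_norm_eq]
  simp only [Complex.add_re, Complex.add_im, Complex.one_re, Complex.one_im, Complex.mul_re,
    Complex.mul_im, Complex.ofReal_re, Complex.ofReal_im, Complex.exp_ofReal_mul_I_re,
    Complex.exp_ofReal_mul_I_im]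
  nlinarith [Real.sin_sq_add_cos_sq φ, sq_nonneg (Real.cos φ + s)]

lemma norm_one_add_mul_exp_neg (s φ : ℝ) :
    ‖1 + s * Complex.exp ((-φ : ℝ) * Complex.I)‖ = ‖1 + s * Complex.exp (φ * Complex.I)‖ := by
  refine (sq_eq_sq₀ (norm_nonneg _) (norm_nonneg _)).1 ?_
  rw [sq_norm_eq, sq_norm_eq]
  simp only [Complex.add_re, Complex.add_im, Complex.one_re, Complex.one_im, Complex.mul_re,
    Complex.mul_im, Complex.ofReal_re, Complex.ofReal_im, Complex.exp_ofReal_mul_I_re,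
    Complex.exp_ofReal_mul_I_im, Real.cos_neg, Real.sin_neg]
  ring

lemma one_add_mul_exp_re_pos {s φ : ℝ} (hs0 : 0 ≤ s) (hs1 : s < 1) :
    0 < (1 + s * Complex.exp (φ * Complex.I)).re := by
  simp only [Complex.add_re, Complex.one_re, Complex.mul_re,
    Complex.ofReal_re, Complex.ofReal_im, Complex.exp_ofReal_mul_I_re]
  nlinarith [Real.neg_one_le_cos φ]

/-- The integral of `1 / |z - 1|` over the arc of radius `sin η` outside the sector. -/
lemma integral_arc_le {η : ℝ} (hη0 : 0 < η) (hη : η < Real.pi / 2) :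
    ∫ φ in (-(Real.pi / 2 + η))..(Real.pi / 2 + η),
      ‖1 + Real.sin η * Complex.exp (φ * Complex.I)‖⁻¹ ≤ 4 * Real.log (4 / Real.cos η) := by
  set s := Real.sin η
  set k := Real.cos η with hk
  have hπ := Real.pi_pos
  have hk0 : 0 < k := Real.cos_pos_of_mem_Ioo ⟨by linarith, hη⟩
  have hs0 : 0 < s := Real.sin_pos_of_pos_of_lt_pi hη0 (by linarith)
  have hsk : s ^ 2 + k ^ 2 = 1 := Real.sin_sq_add_cos_sq η
  have hs1 : s < 1 := by nlinarith
  have hk1 : k ≤ 1 := Real.cos_le_one η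
  set h : ℝ → ℝ := fun φ => ‖1 + s * Complex.exp (φ * Complex.I)‖⁻¹ with hh
  have hpos : ∀ φ : ℝ, 0 < ‖1 + s * Complex.exp (φ * Complex.I)‖ := fun φ => by
    rw [norm_pos_iff]
    intro h0
    have := one_add_mul_exp_re_pos (φ := φ) hs0.le hs1
    rw [h0] at this; simp at this
  have hcont : Continuous h := Continuous.inv₀ (by fun_prop) fun φ => (hpos φ).ne'
  have hi : ∀ a b, IntervalIntegrable h volume a b := fun a b => hcont.intervalIntegrable a b
  have hsym : ∫ φ in (-(Real.pi / 2 + η))..0, h φ = ∫ φ in (0 : ℝ)..(Real.pi / 2 + η), h φ := by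
    rw [← neg_zero, ← intervalIntegral.integral_comp_neg, neg_zero]
    refine intervalIntegral.integral_congr fun φ _ => ?_
    simp only [hh]; rw [norm_one_add_mul_exp_neg]
  -- On this quarter the distance to `1` is at least `1`; beyond `π/2` it is at least `sin φ`, whose
  -- reciprocal has the primitive `log tan (φ/2)`.
  have h1 : ∫ φ in (0 : ℝ)..(Real.pi / 2), h φ ≤ Real.pi / 2 := by
    have : ∫ φ in (0 : ℝ)..(Real.pi / 2), h φ ≤ ∫ _ in (0 : ℝ)..(Real.pi / 2), (1 : ℝ) := by
      refine intervalIntegral.integral_mono_on (by linarith) (hi _ _) (by simp) fun φ hφ => ?_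
      refine inv_le_one_of_one_le₀ ?_
      refine le_trans ?_ (Complex.re_le_norm _)
      have := Real.cos_nonneg_of_mem_Icc ⟨by linarith [hφ.1], hφ.2⟩
      simp only [Complex.add_re, Complex.one_re, Complex.mul_re, Complex.ofReal_re,
        Complex.ofReal_im, Complex.exp_ofReal_mul_I_re]
      nlinarith
    simpa using this
  have hsin : ∀ φ ∈ Icc (Real.pi / 2) (Real.pi / 2 + η), 0 < Real.sin φ := fun φ hφ =>
    Real.sin_pos_of_pos_of_lt_pi (by linarith [hφ.1]) (by linarith [hφ.2])
  have h2 : ∫ φ in (Real.pi / 2)..(Real.pi / 2 + η), h φ ≤ Real.log 2 - Real.log k := by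
    have hci : IntervalIntegrable (fun φ => 1 / Real.sin φ) volume (Real.pi / 2)
        (Real.pi / 2 + η) := by
      refine ContinuousOn.intervalIntegrable ?_
      rw [uIcc_of_le (by linarith)]
      exact continuousOn_const.div Real.continuous_sin.continuousOn fun φ hφ => (hsin φ hφ).ne'
    have : ∫ φ in (Real.pi / 2)..(Real.pi / 2 + η), h φ
        ≤ ∫ φ in (Real.pi / 2)..(Real.pi / 2 + η), 1 / Real.sin φ := by
      refine intervalIntegral.integral_mono_on (by linarith) (hi _ _) hci fun φ hφ => ?_
      rw [one_div]
      exact inv_anti₀ (hsin φ hφ) (sin_le_norm_one_add s φ)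
    refine this.trans ?_
    rw [intervalIntegral.integral_eq_sub_of_hasDerivAt (fun φ hφ =>
      hasDerivAt_log_sin_sub_log_one_add_cos (hsin φ (by rwa [uIcc_of_le (by linarith)] at hφ))) hci]
    have e1 : Real.sin (Real.pi / 2 + η) = k := by rw [add_comm, Real.sin_add_pi_div_two]
    have e2 : Real.cos (Real.pi / 2 + η) = -s := by rw [add_comm, Real.cos_add_pi_div_two]
    rw [e1, e2, Real.sin_pi_div_two, Real.cos_pi_div_two]
    -- `k² = (1 - s)(1 + s) ≤ 2(1 - s)`.
    have h3 : k ^ 2 / 2 ≤ 1 + -s := by nlinarith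
    have h4 := Real.log_le_log (by positivity) h3
    rw [Real.log_div (by positivity) (by norm_num), Real.log_pow] at h4
    simp only [Real.log_one, add_zero, sub_self, sub_zero]
    push_cast at h4
    linarith
  have hlog4 : Real.log 4 = 2 * Real.log 2 := by
    rw [show (4 : ℝ) = 2 ^ 2 by norm_num, Real.log_pow]; norm_num
  have hlogk : Real.log k ≤ 0 := Real.log_nonpos hk0.le hk1
  have hl2 := Real.log_two_gt_d9
  have hπ4 := Real.pi_lt_d2
  have e0 : ∫ φ in (-(Real.pi / 2 + η))..(Real.pi / 2 + η), h φ
      = 2 * ((∫ φ in (0 : ℝ)..(Real.pi / 2), h φ)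
        + ∫ φ in (Real.pi / 2)..(Real.pi / 2 + η), h φ) := by
    rw [← intervalIntegral.integral_add_adjacent_intervals (hi _ 0) (hi 0 _), hsym,
      intervalIntegral.integral_add_adjacent_intervals (hi _ _) (hi _ _)]
    ring
  -- It remains to compare `π + 2 log 2 - 2 log k` with `8 log 2 - 4 log k`; `π ≤ 6 log 2` and `log
  -- k ≤ 0` are enough.
  rw [e0, Real.log_div (by norm_num) hk0.ne', hlog4]
  linarith

end RealEstimates

/-! ### The keyhole boundary as a closed path of four pieces. -/

section Boundary

variable {E : Type*} [NormedAddCommGroup E] [NormedSpace ℂ E] [CompleteSpace E]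

/-- Here `l` is a branch of `log (z - 1)` along the piece, up to a constant, so `P + l A` is an
antiderivative there. Each piece may use its own branch. -/
lemma integral_curve_eq {W : Set ℂ} {F P : ℂ → E} {A : E} (hF : ContinuousOn F W)
    (hP : ∀ z ∈ W, HasDerivAt P (F z - (z - 1)⁻¹ • A) z) {a b : ℝ} {z z' l : ℝ → ℂ}
    (hz : ∀ t ∈ uIcc a b, HasDerivAt z (z' t) t) (hz' : Continuous z')
    (hl : ∀ t ∈ uIcc a b, HasDerivAt l (z' t * (z t - 1)⁻¹) t)
    (hW : ∀ t ∈ uIcc a b, z t ∈ W) :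
    ∫ t in a..b, z' t • F (z t) = P (z b) - P (z a) + (l b - l a) • A := by
  have hzc : ContinuousOn z (uIcc a b) := fun t ht => (hz t ht).continuousAt.continuousWithinAt
  have hd : ∀ t ∈ uIcc a b, HasDerivAt (fun t => P (z t) + l t • A) (z' t • F (z t)) t := by
    intro t ht
    have := ((hP _ (hW t ht)).scomp t (hz t ht)).add ((hl t ht).smul_const A)
    convert! this using 1
    rw [smul_sub, smul_smul]; abel
  rw [intervalIntegral.integral_eq_sub_of_hasDerivAt hd
    (hz'.continuousOn.smul (hF.comp hzc hW)).intervalIntegrable]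
  rw [sub_smul]; abel

/-- The ray `ρ ↦ 1 - ρ e^{iσ}` starting at `1`. -/
def ray (σ ρ : ℝ) : ℂ := 1 - ρ * Complex.exp (σ * Complex.I)

lemma ray_re (σ ρ : ℝ) : (ray σ ρ).re = 1 - ρ * Real.cos σ := by
  simp [ray, Complex.exp_ofReal_mul_I_re]

lemma ray_im (σ ρ : ℝ) : (ray σ ρ).im = -(ρ * Real.sin σ) := by
  simp [ray, Complex.exp_ofReal_mul_I_im]

lemma hasDerivAt_ray (σ ρ : ℝ) :
    HasDerivAt (ray σ) (-Complex.exp (σ * Complex.I)) ρ := by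
  have := ((Complex.ofRealCLM.hasDerivAt (x := ρ)).mul_const
    (Complex.exp (σ * Complex.I))).const_sub 1
  simpa using! this

/-- The arc of radius `s` about the origin, parametrized starting from the negative half-axis. -/
def arc (s φ : ℝ) : ℂ := -(s * Complex.exp (φ * Complex.I))

lemma arc_re (s φ : ℝ) : (arc s φ).re = -(s * Real.cos φ) := by
  simp [arc, Complex.exp_ofReal_mul_I_re]

lemma arc_im (s φ : ℝ) : (arc s φ).im = -(s * Real.sin φ) := by
  simp [arc, Complex.exp_ofReal_mul_I_im]

lemma hasDerivAt_exp_mul_I (φ : ℝ) :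
    HasDerivAt (fun φ : ℝ => Complex.exp (φ * Complex.I)) (Complex.I * Complex.exp (φ * Complex.I)) φ := by
  have := ((Complex.ofRealCLM.hasDerivAt (x := φ)).mul_const Complex.I).cexp
  simpa [mul_comm] using! this

lemma hasDerivAt_arc (s φ : ℝ) :
    HasDerivAt (arc s) (-(s * (Complex.I * Complex.exp (φ * Complex.I)))) φ :=
  ((hasDerivAt_exp_mul_I φ).const_mul (s : ℂ)).neg

/-- The circle of radius `r` about `1`. -/
def smallArc (r ψ : ℝ) : ℂ := 1 + r * Complex.exp (ψ * Complex.I)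

lemma smallArc_re (r ψ : ℝ) : (smallArc r ψ).re = 1 + r * Real.cos ψ := by
  simp [smallArc, Complex.exp_ofReal_mul_I_re]

lemma smallArc_im (r ψ : ℝ) : (smallArc r ψ).im = r * Real.sin ψ := by
  simp [smallArc, Complex.exp_ofReal_mul_I_im]

lemma hasDerivAt_smallArc (r ψ : ℝ) :
    HasDerivAt (smallArc r) (r * (Complex.I * Complex.exp (ψ * Complex.I))) ψ :=
  ((hasDerivAt_exp_mul_I ψ).const_mul (r : ℂ)).const_add 1

/-- A function on the boundary of the keyhole whose primitive has the logarithmic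
period `2πi A`. -/
theorem sum_boundary_integrals {W : Set ℂ} {F P : ℂ → E} {A : E} (hF : ContinuousOn F W)
    (hP : ∀ z ∈ W, HasDerivAt P (F z - (z - 1)⁻¹ • A) z) {η r : ℝ} (hη0 : 0 < η)
    (hη : η < Real.pi / 2) (hr : 0 < r) (hrk : r ≤ Real.cos η)
    (hray : ∀ ρ ∈ Icc r (Real.cos η), ray (-η) ρ ∈ W ∧ ray η ρ ∈ W)
    (harc : ∀ φ ∈ Icc (-(Real.pi / 2 + η)) (Real.pi / 2 + η), arc (Real.sin η) φ ∈ W)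
    (hsm : ∀ ψ ∈ Icc (-(Real.pi - η)) (Real.pi - η), smallArc r ψ ∈ W) :
    (∫ ρ in r..Real.cos η, -Complex.exp ((-η : ℝ) * Complex.I) • F (ray (-η) ρ))
    + (∫ φ in (-(Real.pi / 2 + η))..(Real.pi / 2 + η),
        -(Real.sin η * (Complex.I * Complex.exp (φ * Complex.I))) • F (arc (Real.sin η) φ))
    + (∫ ρ in (Real.cos η)..r, -Complex.exp (η * Complex.I) • F (ray η ρ))
    + (∫ ψ in (-(Real.pi - η))..(Real.pi - η),
        (r * (Complex.I * Complex.exp (ψ * Complex.I))) • F (smallArc r ψ))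
    = (2 * (Real.pi : ℂ) * Complex.I) • A := by
  set s := Real.sin η with hs
  set k := Real.cos η with hk
  have hπ := Real.pi_pos
  have hk0 : 0 < k := hr.trans_le hrk
  have hs0 : 0 < s := Real.sin_pos_of_pos_of_lt_pi hη0 (by linarith)
  have hsk : s ^ 2 + k ^ 2 = 1 := Real.sin_sq_add_cos_sq η
  have hs1 : s < 1 := by nlinarith
  have hlog : ∀ σ ρ : ℝ, 0 < ρ → HasDerivAt (fun t : ℝ => ((Real.log t : ℝ) : ℂ))
      (-Complex.exp (σ * Complex.I) * (ray σ ρ - 1)⁻¹) ρ := by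
    intro σ ρ hρ
    have := (Real.hasDerivAt_log hρ.ne').ofReal_comp
    convert! this using 1
    have n1 : (ρ : ℂ) ≠ 0 := by exact_mod_cast hρ.ne'
    have n2 := Complex.exp_ne_zero (σ * Complex.I)
    have e : ray σ ρ - 1 = -(ρ * Complex.exp (σ * Complex.I)) := by simp [ray]
    rw [e]; push_cast; field_simp
  have hup : uIcc r k = Icc r k := uIcc_of_le hrk
  have hdn : uIcc k r = Icc r k := uIcc_of_ge hrk
  have hua : uIcc (-(Real.pi / 2 + η)) (Real.pi / 2 + η)
      = Icc (-(Real.pi / 2 + η)) (Real.pi / 2 + η) := uIcc_of_le (by linarith)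
  have hus : uIcc (-(Real.pi - η)) (Real.pi - η) = Icc (-(Real.pi - η)) (Real.pi - η) :=
    uIcc_of_le (by linarith)
  have i1 := integral_curve_eq hF hP (a := r) (b := k) (z := ray (-η))
    (z' := fun _ => -Complex.exp ((-η : ℝ) * Complex.I)) (l := fun t => ((Real.log t : ℝ) : ℂ))
    (fun t _ => hasDerivAt_ray _ t) continuous_const
    (fun t ht => hlog _ t (hr.trans_le (hup ▸ ht).1)) (fun t ht => (hray t (hup ▸ ht)).1)
  have i3 := integral_curve_eq hF hP (a := k) (b := r) (z := ray η)
    (z' := fun _ => -Complex.exp (η * Complex.I)) (l := fun t => ((Real.log t : ℝ) : ℂ))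
    (fun t _ => hasDerivAt_ray _ t) continuous_const
    (fun t ht => hlog _ t (hr.trans_le (hdn ▸ ht).1)) (fun t ht => (hray t (hdn ▸ ht)).2)
  -- On the large arc the branch is the principal `log (1 - z)`: since `s < 1`, `1 - z` has positive
  -- real part.
  have i2 := integral_curve_eq hF hP (a := -(Real.pi / 2 + η)) (b := Real.pi / 2 + η) (z := arc s)
    (z' := fun φ => -(s * (Complex.I * Complex.exp (φ * Complex.I))))
    (l := fun φ => Complex.log (1 + s * Complex.exp (φ * Complex.I)))
    (fun t _ => hasDerivAt_arc _ t) (by fun_prop)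
    (fun φ _ => by
      have hre := one_add_mul_exp_re_pos (φ := φ) hs0.le hs1
      have hd := (((hasDerivAt_exp_mul_I φ).const_mul (s : ℂ)).const_add 1).clog_real
        (Or.inl hre)
      convert! hd using 1
      have e : arc s φ - 1 = -(1 + s * Complex.exp (φ * Complex.I)) := by simp [arc]; ring
      rw [e, inv_neg, neg_mul_neg, div_eq_mul_inv])
    (fun φ hφ => harc φ (hua ▸ hφ))
  have i4 := integral_curve_eq hF hP (a := -(Real.pi - η)) (b := Real.pi - η) (z := smallArc r)
    (z' := fun ψ => r * (Complex.I * Complex.exp (ψ * Complex.I)))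
    (l := fun ψ => (ψ : ℂ) * Complex.I)
    (fun t _ => hasDerivAt_smallArc _ t) (by fun_prop)
    (fun ψ _ => by
      have hd := (Complex.ofRealCLM.hasDerivAt (x := ψ)).mul_const Complex.I
      convert! hd using 1
      have n1 : (r : ℂ) ≠ 0 := by exact_mod_cast hr.ne'
      have n2 := Complex.exp_ne_zero (ψ * Complex.I)
      have e : smallArc r ψ - 1 = r * Complex.exp (ψ * Complex.I) := by simp [smallArc]
      rw [e]; simp; field_simp)
    (fun ψ hψ => hsm ψ (hus ▸ hψ))
  have c1 : Real.cos (Real.pi / 2 + η) = -s := by rw [add_comm, Real.cos_add_pi_div_two]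
  have c2 : Real.sin (Real.pi / 2 + η) = k := by rw [add_comm, Real.sin_add_pi_div_two]
  have p12 : ray (-η) k = arc s (-(Real.pi / 2 + η)) := by
    apply Complex.ext
    · rw [ray_re, arc_re, Real.cos_neg, Real.cos_neg, c1, ← hk]; nlinarith
    · rw [ray_im, arc_im, Real.sin_neg, Real.sin_neg, c2, ← hs]; ring
  have p23 : arc s (Real.pi / 2 + η) = ray η k := by
    apply Complex.ext
    · rw [ray_re, arc_re, c1, ← hk]; nlinarith
    · rw [ray_im, arc_im, c2, ← hs]; ring
  have p34 : ray η r = smallArc r (-(Real.pi - η)) := by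
    apply Complex.ext
    · rw [ray_re, smallArc_re, Real.cos_neg, Real.cos_pi_sub]; ring
    · rw [ray_im, smallArc_im, Real.sin_neg, Real.sin_pi_sub]; ring
  have p41 : smallArc r (Real.pi - η) = ray (-η) r := by
    apply Complex.ext
    · rw [ray_re, smallArc_re, Real.cos_neg, Real.cos_pi_sub]; ring
    · rw [ray_im, smallArc_im, Real.sin_neg, Real.sin_pi_sub]; ring
  have hlogval : ∀ σ : ℝ, |σ| < Real.pi →
      Complex.log (k * Complex.exp (σ * Complex.I)) = Real.log k + σ * Complex.I := by
    intro σ hσ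
    have : (k : ℂ) * Complex.exp (σ * Complex.I)
        = Complex.exp (Real.log k + σ * Complex.I) := by
      rw [Complex.exp_add, ← Complex.ofReal_exp, Real.exp_log hk0]
    rw [abs_lt] at hσ
    rw [this, Complex.log_exp (by simpa using hσ.1) (by simpa using hσ.2.le)]
  have l2 : Complex.log (1 + s * Complex.exp (((Real.pi / 2 + η : ℝ) : ℂ) * Complex.I))
      = Real.log k + η * Complex.I := by
    rw [← hlogval η (by rw [abs_of_pos hη0]; linarith)]
    have : 1 - arc s (Real.pi / 2 + η) = 1 - ray η k := by rw [p23]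
    simp only [arc, ray] at this
    congr 1; linear_combination this
  have l1 : Complex.log (1 + s * Complex.exp (((-(Real.pi / 2 + η) : ℝ) : ℂ) * Complex.I))
      = Real.log k + ((-η : ℝ) : ℂ) * Complex.I := by
    rw [← hlogval (-η) (by rw [abs_neg, abs_of_pos hη0]; linarith)]
    have : 1 - arc s (-(Real.pi / 2 + η)) = 1 - ray (-η) k := by rw [p12]
    simp only [arc, ray] at this
    congr 1; linear_combination this
  rw [i1, i2, i3, i4, p12, p23, p34, p41, l1, l2]
  -- The values of `P` telescope. The real logarithms cancel, the large arc contributes `2iη` and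
  -- the small one `2i(π - η)`.
  have e : ∀ (x y z w : E) (α β γ δ : ℂ),
      (x - y + α • A) + (z - x + β • A) + (w - z + γ • A) + (y - w + δ • A)
        = (α + β + γ + δ) • A := by
    intros; simp only [add_smul]; abel
  rw [e]
  congr 1
  push_cast
  ring

end Boundary

/-! ### Estimates on the keyhole boundary and its position. -/

section Estimate

/-- The boundary of the keyhole domain with tangent rays cut off at distance `r` from `1`. -/
def keyholeBoundary (η r : ℝ) : Set ℂ :=
  ((ray (-η) '' Icc r (Real.cos η) ∪ ray η '' Icc r (Real.cos η)) ∪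
    arc (Real.sin η) '' Icc (-(Real.pi / 2 + η)) (Real.pi / 2 + η)) ∪
    smallArc r '' Icc (-(Real.pi - η)) (Real.pi - η)

theorem norm_le_of_boundary {E : Type*} [NormedAddCommGroup E] [NormedSpace ℂ E] [CompleteSpace E]
    {W : Set ℂ} {F P : ℂ → E} {A : E} (hF : ContinuousOn F W)
    (hP : ∀ z ∈ W, HasDerivAt P (F z - (z - 1)⁻¹ • A) z) {η r : ℝ} (hη0 : 0 < η)
    (hη : η < Real.pi / 2) (hr : 0 < r) {m : ℕ} {B : ℝ} (hB0 : 0 ≤ B)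
    (hW : keyholeBoundary η (min r (Real.cos η)) ⊆ W)
    (hB : ∀ z ∈ keyholeBoundary η (min r (Real.cos η)), ‖F z‖ ≤ B * ‖z‖ ^ m / ‖z - 1‖) :
    2 * Real.pi * ‖A‖ ≤ B * keyholeConst r m η := by
  set s := Real.sin η with hs
  set k := Real.cos η with hk
  -- For `r > cos η` the circle of radius `r` about `1` would reach beyond the tangent points; at
  -- radius `cos η` the rays degenerate, and the bounds in terms of `r` still hold.
  set q := min r k with hq
  have hπ := Real.pi_pos
  have hk0 : 0 < k := Real.cos_pos_of_mem_Ioo ⟨by linarith, hη⟩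
  have hs0 : 0 < s := Real.sin_pos_of_pos_of_lt_pi hη0 (by linarith)
  have hk1 : k ≤ 1 := Real.cos_le_one η
  have hsk : s ^ 2 + k ^ 2 = 1 := Real.sin_sq_add_cos_sq η
  have hs1 : s < 1 := by nlinarith
  have hq0 : 0 < q := lt_min hr hk0
  have hqk : q ≤ k := min_le_right _ _
  have hqr : q ≤ r := min_le_left _ _
  have m1 : ∀ ρ ∈ Icc q k, ray (-η) ρ ∈ keyholeBoundary η q := fun ρ hρ =>
    Or.inl (Or.inl (Or.inl ⟨ρ, hρ, rfl⟩))
  have m3 : ∀ ρ ∈ Icc q k, ray η ρ ∈ keyholeBoundary η q := fun ρ hρ =>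
    Or.inl (Or.inl (Or.inr ⟨ρ, hρ, rfl⟩))
  have m2 : ∀ φ ∈ Icc (-(Real.pi / 2 + η)) (Real.pi / 2 + η), arc s φ ∈ keyholeBoundary η q :=
    fun φ hφ => Or.inl (Or.inr ⟨φ, hφ, rfl⟩)
  have m4 : ∀ ψ ∈ Icc (-(Real.pi - η)) (Real.pi - η), smallArc q ψ ∈ keyholeBoundary η q :=
    fun ψ hψ => Or.inr ⟨ψ, hψ, rfl⟩
  have hsum := sum_boundary_integrals hF hP hη0 hη hq0 hqk
    (fun ρ hρ => ⟨hW (m1 ρ hρ), hW (m3 ρ hρ)⟩) (fun φ hφ => hW (m2 φ hφ))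
    (fun ψ hψ => hW (m4 ψ hψ))
  set a : ℝ := ((m : ℝ) + 1) / 2 * k with ha
  have ha0 : 0 < a := by positivity
  have hexp1 : ∀ x : ℝ, ‖Complex.exp (x * Complex.I)‖ = 1 := Complex.norm_exp_ofReal_mul_I
  have hrayb : ∀ σ : ℝ, Real.cos σ = k → Real.sin σ ^ 2 = s ^ 2 →
      (∀ ρ ∈ Icc q k, ray σ ρ ∈ keyholeBoundary η q) →
      ‖∫ ρ in q..k, -Complex.exp (σ * Complex.I) • F (ray σ ρ)‖ ≤ 2 * B * Ei (a * r) := by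
    intro σ hσ hσ2 hmem
    have hci : IntervalIntegrable (fun ρ => (2 * B) * (Real.exp (-(a * ρ)) / ρ)) volume q k := by
      refine ContinuousOn.intervalIntegrable ?_
      rw [uIcc_of_le hqk]
      exact continuousOn_const.mul (ContinuousOn.div (by fun_prop) continuousOn_id
        fun ρ hρ => (hq0.trans_le hρ.1).ne')
    have h1 : ‖∫ ρ in q..k, -Complex.exp (σ * Complex.I) • F (ray σ ρ)‖
        ≤ ∫ ρ in q..k, (2 * B) * (Real.exp (-(a * ρ)) / ρ) := by
      refine intervalIntegral.norm_integral_le_of_norm_le hqk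
        (Eventually.of_forall fun ρ hρ => ?_) hci
      have hρ0 : 0 < ρ := hq0.trans hρ.1
      have e1 : ‖ray σ ρ - 1‖ = ρ := by
        simp [ray, hexp1, abs_of_pos hρ0]
      have h2 := hB _ (hmem ρ ⟨hρ.1.le, hρ.2⟩)
      rw [e1] at h2
      rw [norm_smul, norm_neg, hexp1, one_mul]
      refine h2.trans ?_
      have h3 := norm_ray_pow_le hk1 hρ0.le hρ.2 m (z := ray σ ρ) (by
        rw [sq_norm_eq, ray_re, ray_im, hσ]
        nlinarith)
      calc B * ‖ray σ ρ‖ ^ m / ρ ≤ B * (2 * Real.exp (-(a * ρ))) / ρ := by gcongr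
        _ = _ := by ring
    refine h1.trans ?_
    rw [intervalIntegral.integral_const_mul]
    exact mul_le_mul_of_nonneg_left (integral_exp_neg_mul_div_le ha0 hr) (by positivity)
  have b1 := hrayb (-η) (by rw [Real.cos_neg]) (by rw [Real.sin_neg, neg_sq]) m1
  have b3 := hrayb η rfl rfl m3
  rw [← norm_neg, ← intervalIntegral.integral_symm] at b3
  have b2 : ‖∫ φ in (-(Real.pi / 2 + η))..(Real.pi / 2 + η),
      -((s : ℂ) * (Complex.I * Complex.exp (φ * Complex.I))) • F (arc s φ)‖
      ≤ B * (4 * s ^ (m + 1) * Real.log (4 / k)) := by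
    have hne : ∀ φ : ℝ, ‖1 + (s : ℂ) * Complex.exp (φ * Complex.I)‖ ≠ 0 := fun φ h => by
      have := one_add_mul_exp_re_pos (φ := φ) hs0.le hs1
      rw [norm_eq_zero.1 h] at this; simp at this
    have hci : Continuous fun φ : ℝ => (B * s ^ (m + 1)) *
        ‖1 + (s : ℂ) * Complex.exp (φ * Complex.I)‖⁻¹ :=
      continuous_const.mul (Continuous.inv₀ (by fun_prop) hne)
    have h1 : ‖∫ φ in (-(Real.pi / 2 + η))..(Real.pi / 2 + η),
        -((s : ℂ) * (Complex.I * Complex.exp (φ * Complex.I))) • F (arc s φ)‖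
        ≤ ∫ φ in (-(Real.pi / 2 + η))..(Real.pi / 2 + η),
          (B * s ^ (m + 1)) * ‖1 + (s : ℂ) * Complex.exp (φ * Complex.I)‖⁻¹ := by
      refine intervalIntegral.norm_integral_le_of_norm_le (by linarith)
        (Eventually.of_forall fun φ hφ => ?_) (hci.intervalIntegrable _ _)
      have h2 := hB _ (m2 φ ⟨hφ.1.le, hφ.2⟩)
      have e1 : ‖arc s φ - 1‖ = ‖1 + (s : ℂ) * Complex.exp (φ * Complex.I)‖ := by
        rw [← norm_neg]; congr 1; simp [arc]
      have e2 : ‖arc s φ‖ = s := by simp [arc, hexp1, abs_of_pos hs0]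
      rw [e1, e2] at h2
      rw [norm_smul, norm_neg, norm_mul, norm_mul, hexp1, Complex.norm_I, Complex.norm_real,
        Real.norm_eq_abs, abs_of_pos hs0, mul_one, mul_one]
      calc s * ‖F (arc s φ)‖
          ≤ s * (B * s ^ m / ‖1 + (s : ℂ) * Complex.exp (φ * Complex.I)‖) := by gcongr
        _ = _ := by rw [div_eq_mul_inv, pow_succ]; ring
    refine h1.trans ?_
    rw [intervalIntegral.integral_const_mul]
    calc _ ≤ B * s ^ (m + 1) * (4 * Real.log (4 / k)) :=
          mul_le_mul_of_nonneg_left (integral_arc_le hη0 hη) (by positivity)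
      _ = _ := by ring
  have b4 : ‖∫ ψ in (-(Real.pi - η))..(Real.pi - η),
      ((q : ℂ) * (Complex.I * Complex.exp (ψ * Complex.I))) • F (smallArc q ψ)‖
      ≤ B * (2 * Real.pi * (1 + r) ^ m) := by
    have h1 := intervalIntegral.norm_integral_le_of_norm_le_const (a := -(Real.pi - η))
      (b := Real.pi - η) (C := B * (1 + r) ^ m)
      (f := fun ψ : ℝ => ((q : ℂ) * (Complex.I * Complex.exp (ψ * Complex.I))) • F (smallArc q ψ))
      (fun ψ hψ => by
        rw [uIoc_of_le (by linarith)] at hψ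
        have h2 := hB _ (m4 ψ ⟨hψ.1.le, hψ.2⟩)
        have e1 : ‖smallArc q ψ - 1‖ = q := by simp [smallArc, hexp1, abs_of_pos hq0]
        have e2 : ‖smallArc q ψ‖ ≤ 1 + r := by
          refine (norm_add_le _ _).trans ?_
          rw [norm_one, norm_mul, hexp1, Complex.norm_real, Real.norm_eq_abs, abs_of_pos hq0]
          linarith
        rw [e1] at h2
        rw [norm_smul, norm_mul, norm_mul, hexp1, Complex.norm_I, Complex.norm_real,
          Real.norm_eq_abs, abs_of_pos hq0, mul_one, mul_one]
        calc q * ‖F (smallArc q ψ)‖ ≤ q * (B * ‖smallArc q ψ‖ ^ m / q) := by gcongr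
          _ = B * ‖smallArc q ψ‖ ^ m := by field_simp
          _ ≤ B * (1 + r) ^ m := by gcongr)
    refine h1.trans ?_
    rw [abs_of_pos (by linarith)]
    have : 0 ≤ B * (1 + r) ^ m := by positivity
    nlinarith
  have hJ : ‖(2 * (Real.pi : ℂ) * Complex.I) • A‖ = 2 * Real.pi * ‖A‖ := by
    rw [norm_smul]; simp [abs_of_pos hπ]
  rw [← hJ, ← hsum]
  refine (norm_add_le _ _).trans ((add_le_add_left (norm_add₃_le) _).trans ?_)
  have hE : Ei (r * (((m : ℝ) + 1) / 2) * k) = Ei (a * r) := by congr 1; rw [ha]; ring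
  have hfin : B * keyholeConst r m η = 2 * B * Ei (a * r)
      + B * (4 * s ^ (m + 1) * Real.log (4 / k)) + 2 * B * Ei (a * r)
      + B * (2 * Real.pi * (1 + r) ^ m) := by
    rw [keyholeConst, ← hs, ← hk, hE]; ring
  rw [hfin]
  exact add_le_add (add_le_add (add_le_add b1 b2) b3) b4

/-- Each point of the keyhole boundary is separated from the Stolz domain by a half-plane. -/
lemma exists_halfPlane_of_mem_keyholeBoundary {η r : ℝ} (hη0 : 0 < η) (hη : η < Real.pi / 2)
    (hr : 0 < r) {z : ℂ} (hz : z ∈ keyholeBoundary η r) :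
    z ≠ 1 ∧ ∃ u : ℂ, ‖u‖ = 1 ∧ u.re ≤ Real.sin η ∧ Real.sin η ≤ u.re * z.re + u.im * z.im := by
  set s := Real.sin η with hs
  set k := Real.cos η with hk
  have hπ := Real.pi_pos
  have hk0 : 0 < k := Real.cos_pos_of_mem_Ioo ⟨by linarith, hη⟩
  have hs0 : 0 < s := Real.sin_pos_of_pos_of_lt_pi hη0 (by linarith)
  have hsk : s ^ 2 + k ^ 2 = 1 := Real.sin_sq_add_cos_sq η
  have hs1 : s < 1 := by nlinarith
  have hu1 : ‖(⟨s, k⟩ : ℂ)‖ = 1 := by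
    refine (sq_eq_sq₀ (norm_nonneg _) zero_le_one).1 ?_
    rw [sq_norm_eq, one_pow]; exact hsk
  have hu2 : ‖(⟨s, -k⟩ : ℂ)‖ = 1 := by
    refine (sq_eq_sq₀ (norm_nonneg _) zero_le_one).1 ?_
    rw [sq_norm_eq, one_pow]; simpa using hsk
  have hexp1 : ∀ x : ℝ, ‖Complex.exp (x * Complex.I)‖ = 1 := Complex.norm_exp_ofReal_mul_I
  have hrayne : ∀ σ ρ : ℝ, 0 < ρ → ray σ ρ ≠ 1 := fun σ ρ hρ h => by
    have e : ‖ray σ ρ - 1‖ = ρ := by simp [ray, hexp1, abs_of_pos hρ]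
    rw [h] at e; simp at e; linarith
  rcases hz with ((⟨ρ, hρ, rfl⟩ | ⟨ρ, hρ, rfl⟩) | ⟨φ, hφ, rfl⟩) | ⟨ψ, hψ, rfl⟩
  · refine ⟨hrayne _ _ (hr.trans_le hρ.1), ⟨s, k⟩, hu1, le_rfl, ?_⟩
    rw [ray_re, ray_im, Real.cos_neg, Real.sin_neg, ← hs, ← hk]
    exact le_of_eq (by ring)
  · refine ⟨hrayne _ _ (hr.trans_le hρ.1), ⟨s, -k⟩, hu2, le_rfl, ?_⟩
    rw [ray_re, ray_im, ← hs, ← hk]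
    exact le_of_eq (by ring)
  -- The normal is the radial one; `|φ| ≤ π/2 + η` is what makes its real part at most `sin η`.
  · refine ⟨fun h => ?_, arc 1 φ, by simp [arc, hexp1], ?_, ?_⟩
    · have e : ‖arc s φ‖ = s := by simp [arc, hexp1, abs_of_pos hs0]
      rw [h, norm_one] at e; linarith
    · rw [arc_re, one_mul]
      have hc : Real.cos (Real.pi / 2 + η) ≤ Real.cos |φ| :=
        Real.cos_le_cos_of_nonneg_of_le_pi (abs_nonneg _) (by linarith) (abs_le.2 hφ)
      rw [Real.cos_abs, add_comm, Real.cos_add_pi_div_two] at hc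
      linarith
    · rw [arc_re, arc_im, arc_re, arc_im]
      have := Real.sin_sq_add_cos_sq φ
      exact le_of_eq (by linear_combination -s * this)
  · refine ⟨fun h => ?_, ?_⟩
    · have e : ‖smallArc r ψ - 1‖ = r := by simp [smallArc, hexp1, abs_of_pos hr]
      rw [h] at e; simp at e; linarith
    -- The upper half of the small arc is separated by the upper tangent line, the lower half by its
    -- conjugate; the inequality reduces to `sin (η ± ψ) ≥ 0`.
    · rcases le_total 0 ψ with h0 | h0
      · refine ⟨⟨s, k⟩, hu1, le_rfl, ?_⟩
        have h1 : 0 ≤ Real.sin (η + ψ) :=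
          Real.sin_nonneg_of_nonneg_of_le_pi (by linarith) (by linarith [hψ.2])
        rw [Real.sin_add, ← hs, ← hk] at h1
        rw [smallArc_re, smallArc_im]
        nlinarith
      · refine ⟨⟨s, -k⟩, hu2, le_rfl, ?_⟩
        have h1 : 0 ≤ Real.sin (η - ψ) :=
          Real.sin_nonneg_of_nonneg_of_le_pi (by linarith) (by linarith [hψ.1])
        rw [Real.sin_sub, ← hs, ← hk] at h1
        rw [smallArc_re, smallArc_im]
        nlinarith

lemma keyholeBoundary_subset {η r : ℝ} (hη0 : 0 < η) (hη : η < Real.pi / 2) (hr : 0 < r) :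
    keyholeBoundary η (min r (Real.cos η)) ⊆ closure (stolz η) ∪ closedBall 1 r := by
  have hπ := Real.pi_pos
  have hk0 : 0 < Real.cos η := Real.cos_pos_of_mem_Ioo ⟨by linarith, hη⟩
  have hs0 : 0 < Real.sin η := Real.sin_pos_of_pos_of_lt_pi hη0 (by linarith)
  have hsk : Real.sin η ^ 2 + Real.cos η ^ 2 = 1 := Real.sin_sq_add_cos_sq η
  have hq0 : 0 < min r (Real.cos η) := lt_min hr hk0
  have hexp1 : ∀ x : ℝ, ‖Complex.exp (x * Complex.I)‖ = 1 := Complex.norm_exp_ofReal_mul_I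
  have hray : ∀ σ : ℝ, Real.cos σ = Real.cos η → Real.sin σ ^ 2 = Real.sin η ^ 2 →
      ∀ ρ ∈ Icc (min r (Real.cos η)) (Real.cos η), ray σ ρ ∈ closedStolz η := by
    intro σ hσ hσ2 ρ hρ
    have hρ0 : 0 < ρ := hq0.trans_le hρ.1
    refine (mem_closedStolz_iff hs0.le).2 ⟨ρ / Real.cos η,
      ⟨by positivity, (div_le_one hk0).2 hρ.2⟩, ray σ (Real.cos η), ?_, ?_⟩
    · rw [mem_closedBall_zero_iff]
      refine abs_le_of_sq_le_sq' ?_ hs0.le |>.2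
      rw [sq_norm_eq, ray_re, ray_im, hσ]
      nlinarith
    · have n1 : (Real.cos η : ℂ) ≠ 0 := by exact_mod_cast hk0.ne'
      simp only [ray, Complex.real_smul]
      push_cast at n1 ⊢
      field_simp
      ring
  rintro z (((⟨ρ, hρ, rfl⟩ | ⟨ρ, hρ, rfl⟩) | ⟨φ, hφ, rfl⟩) | ⟨ψ, hψ, rfl⟩)
  · exact Or.inl (closedStolz_subset_closure hs0
      (hray _ (Real.cos_neg η) (by rw [Real.sin_neg, neg_sq]) ρ hρ))
  · exact Or.inl (closedStolz_subset_closure hs0 (hray _ rfl rfl ρ hρ))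
  · refine Or.inl (closedStolz_subset_closure hs0 (closedBall_subset_closedStolz η ?_))
    rw [mem_closedBall_zero_iff]
    exact le_of_eq (by simp [-Complex.ofReal_sin, arc, hexp1, abs_of_pos hs0])
  · refine Or.inr ?_
    rw [mem_closedBall, dist_eq_norm]
    have : ‖smallArc (min r (Real.cos η)) ψ - 1‖ = min r (Real.cos η) := by
      rw [smallArc, add_sub_cancel_left, norm_mul, hexp1, Complex.norm_real, Real.norm_eq_abs,
        abs_of_pos hq0, mul_one]
    rw [this]; exact min_le_left _ _

lemma isOpen_keyhole (η r : ℝ) : IsOpen (keyhole η r) := (isOpen_stolz η).union isOpen_ball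

/-- Contracting a convex set towards an interior point sends its closure into its interior. Taking
`c` in both pieces of the keyhole makes one contraction serve for the union. -/
lemma add_smul_sub_mem_keyhole {η r : ℝ} (hr : 0 < r) {c : ℂ} (hc : c ∈ stolz η)
    (hc' : c ∈ ball (1 : ℂ) r) {z : ℂ} (hz : z ∈ closure (stolz η) ∪ closedBall 1 r) {t : ℝ}
    (ht0 : 0 ≤ t) (ht1 : t < 1) : c + t • (z - c) ∈ keyhole η r := by
  have e : c + t • (z - c) = (1 - t) • c + t • z := by
    simp only [Complex.real_smul]; push_cast; ring
  rw [e]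
  rcases hz with hz | hz
  · refine Or.inl ?_
    have h := (convex_stolz η).combo_interior_closure_mem_interior
      (by rwa [(isOpen_stolz η).interior_eq]) hz (a := 1 - t) (b := t) (by linarith) ht0 (by ring)
    exact interior_subset h
  · refine Or.inr ?_
    rw [← closure_ball (1 : ℂ) hr.ne'] at hz
    have h := (convex_ball (1 : ℂ) r).combo_interior_closure_mem_interior
      (by rwa [isOpen_ball.interior_eq]) hz (a := 1 - t) (b := t) (by linarith) ht0 (by ring)
    exact interior_subset h

lemma starConvex_keyhole {η r : ℝ} {c : ℂ} (hc : c ∈ stolz η) (hc' : c ∈ ball (1 : ℂ) r) :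
    StarConvex ℝ c (keyhole η r) :=
  ((convex_stolz η) hc).union ((convex_ball (1 : ℂ) r) hc')

lemma exists_mem_stolz_inter_ball {η r : ℝ} (hs : 0 < Real.sin η) (hr : 0 < r) :
    ∃ c ∈ stolz η, c ∈ ball (1 : ℂ) r := by
  obtain ⟨c, hc, hc'⟩ := mem_closure_iff.1 (one_mem_closure_stolz hs) (ball 1 r) isOpen_ball
    (mem_ball_self hr)
  exact ⟨c, hc', hc⟩

end Estimate

/-! ### The norm bound, and the limit of dilations. -/

section Main

variable {X : Type*} [NormedAddCommGroup X] [NormedSpace ℂ X] [CompleteSpace X]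

/-- The norm estimate for a function holomorphic and bounded beyond the closed keyhole. -/
theorem norm_calculus_le {T : X →L[ℂ] X} {θ η r M : ℝ} {m : ℕ} (hθ : 0 ≤ Real.sin θ)
    (hθη : Real.sin θ < Real.sin η) (hη0 : 0 < η) (hη : η < Real.pi / 2) (hr : 0 < r)
    (hσ : spectrum ℂ T ⊆ closedStolz θ) (hb : BddAbove (sectorValues T η)) {D : Set ℂ} {c : ℂ}
    (hD : IsOpen D) (hDc : StarConvex ℝ c D) (hDη : closure (stolz η) ∪ closedBall 1 r ⊆ D)
    (hKD : keyhole η r ⊆ D) {f : ℂ → ℂ} (hf : DifferentiableOn ℂ f D) (hM : ∀ z ∈ D, ‖f z‖ ≤ M)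
    {γ : ℝ → ℂ} (hγ : IsContourAround (closedStolz θ) (keyhole η r) γ) :
    ‖(2 * (Real.pi : ℂ) * Complex.I)⁻¹ •
      contourIntegral γ (fun z => (f z * z ^ m) • resolvent T z)‖
      ≤ sectorConst T η / (2 * Real.pi) * keyholeConst r m η * M := by
  have hg : DifferentiableOn ℂ (fun z => f z * z ^ m) D := hf.mul (by fun_prop)
  obtain ⟨P, hP⟩ := exists_primitive_smul_resolvent_sub (a := T) (isCompact_closedStolz hθ)
    (starConvex_closedStolz θ) (one_mem_closedStolz θ) hσ hD hDc hg hKD hγ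
  have hs0 : 0 < Real.sin η := hθ.trans_lt hθη
  have hk0 : 0 < Real.cos η := Real.cos_pos_of_mem_Ioo ⟨by linarith [Real.pi_pos], hη⟩
  have hq0 : 0 < min r (Real.cos η) := lt_min hr hk0
  have hC0 : 0 ≤ sectorConst T η := by
    refine Real.sSup_nonneg ?_
    rintro _ ⟨z, _, rfl⟩; exact norm_nonneg _
  have hM0 : 0 ≤ M := (norm_nonneg _).trans (hM 1 (hDη (Or.inl (one_mem_closure_stolz hs0))))
  have hcont : ContinuousOn (fun z => (f z * z ^ m) • resolvent T z) (D \ closedStolz θ) :=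
    (hg.continuousOn.mono sdiff_subset).smul
      ((differentiableOn_resolvent hσ).continuousOn.mono fun z hz => hz.2)
  have hbd : ∀ z ∈ keyholeBoundary η (min r (Real.cos η)), z ∈ D ∧ z ∉ closedStolz θ ∧
      ‖resolvent T z‖ ≤ sectorConst T η / ‖z - 1‖ := by
    intro z hz
    obtain ⟨hz1, u, hu, hus, huz⟩ := exists_halfPlane_of_mem_keyholeBoundary hη0 hη hq0 hz
    obtain ⟨hzK, hzc⟩ := notMem_closedStolz_of_halfPlane hθ hθη hu hus hz1 huz
    exact ⟨hDη (keyholeBoundary_subset hη0 hη hr hz), hzK,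
      norm_resolvent_le_of_mem_closure hb (by_contra fun h => hzK (hσ h)) hz1 hzc⟩
  have key := norm_le_of_boundary (B := M * sectorConst T η) (m := m) hcont hP hη0 hη hr
    (by positivity) (fun z hz => ⟨(hbd z hz).1, (hbd z hz).2.1⟩) (fun z hz => by
      obtain ⟨h1, -, h3⟩ := hbd z hz
      rw [norm_smul, norm_mul, norm_pow]
      calc ‖f z‖ * ‖z‖ ^ m * ‖resolvent T z‖
          ≤ M * ‖z‖ ^ m * (sectorConst T η / ‖z - 1‖) := by gcongr; exact hM z h1
        _ = _ := by ring)
  rw [← le_div_iff₀' (by positivity)] at key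
  refine key.trans_eq ?_
  ring

theorem exists_calculus {T : X →L[ℂ] X} {θ η r : ℝ} (m : ℕ) (hθ : 0 ≤ Real.sin θ)
    (hθη : Real.sin θ < Real.sin η) (hη0 : 0 < η) (hη : η < Real.pi / 2) (hr : 0 < r)
    (hσ : spectrum ℂ T ⊆ closedStolz θ) (hb : BddAbove (sectorValues T η)) {f : ℂ → ℂ}
    (hf : DifferentiableOn ℂ f (keyhole η r))
    (hfb : BddAbove ((fun z => ‖f z‖) '' keyhole η r)) :
    ∃ A : X →L[ℂ] X, IsRieszDunford (closedStolz θ) (keyhole η r) T (fun z => f z * z ^ m) A ∧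
      ‖A‖ ≤ sectorConst T η / (2 * Real.pi) * keyholeConst r m η * supNorm f (keyhole η r) := by
  set K := closedStolz θ with hK
  set Ω := keyhole η r with hΩ
  have hs0 : 0 < Real.sin η := hθ.trans_lt hθη
  have hKc : IsCompact K := isCompact_closedStolz hθ
  have hΩo : IsOpen Ω := isOpen_keyhole η r
  have hKΩ : K ⊆ Ω := fun w hw => by
    by_cases h1 : w = 1
    · exact Or.inr (h1 ▸ mem_ball_self hr)
    · exact Or.inl (mem_stolz_of_mem_closedStolz hθ hθη hw h1)
  obtain ⟨γ, hγ⟩ := exists_isContourAround hKc (convex_convexHull ℝ _) (one_mem_closedStolz θ)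
    hΩo hKΩ
  obtain ⟨c, hc, hc'⟩ := exists_mem_stolz_inter_ball hs0 hr
  have hstar : StarConvex ℝ c Ω := starConvex_keyhole hc hc'
  have hg : DifferentiableOn ℂ (fun z => f z * z ^ m) Ω := hf.mul (by fun_prop)
  obtain ⟨P, hP⟩ := exists_primitive_smul_resolvent_sub (a := T) hKc
    (starConvex_closedStolz θ) (one_mem_closedStolz θ) hσ hΩo hstar hg Subset.rfl hγ
  have hcont : ContinuousOn (fun z => (f z * z ^ m) • resolvent T z) (Ω \ K) :=
    (hg.continuousOn.mono sdiff_subset).smul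
      ((differentiableOn_resolvent hσ).continuousOn.mono fun z hz => hz.2)
  set J : ℂ := 2 * (Real.pi : ℂ) * Complex.I with hJ
  refine ⟨J⁻¹ • contourIntegral γ (fun z => (f z * z ^ m) • resolvent T z),
    ⟨hσ, ⟨γ, hγ⟩, fun γ' hγ' => ?_⟩, ?_⟩
  · rw [contourIntegral_eq_of_primitive hKc.isClosed hΩo (one_mem_closedStolz θ) hγ' hcont hP,
      inv_smul_smul₀ Complex.two_pi_I_ne_zero]
  set M := supNorm f Ω with hM
  have hfM : ∀ z ∈ Ω, ‖f z‖ ≤ M := fun z hz => le_csSup hfb ⟨z, hz, rfl⟩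
  obtain ⟨L, hL⟩ := hγ.lipschitz
  have hhc : ContinuousOn (fun t => (γ t) ^ m • resolvent T (γ t)) (Icc 0 1) :=
    (hL.continuousOn.pow m).smul (continuousOn_comp_contour hγ
      ((differentiableOn_resolvent hσ).continuousOn.mono fun z hz => hz.2))
  obtain ⟨B, hB⟩ := isCompact_Icc.exists_bound_of_continuousOn hhc
  -- For `t < 1` the dilated function is holomorphic beyond the closed keyhole and still bounded by
  -- `M`; on the fixed contour its integrals converge to that of `f`.
  set f' : ℝ → ℂ → ℂ := fun t z => f (c + t • (z - c)) with hf'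
  have hmem : ∀ t ∈ Ico (0 : ℝ) 1, ∀ z ∈ Ω, c + t • (z - c) ∈ Ω := fun t ht z hz =>
    hstar.add_smul_sub_mem hz ht.1 ht.2.le
  have hIco : Ico (0 : ℝ) 1 ∈ 𝓝[<] (1 : ℝ) := Ico_mem_nhdsLT one_pos
  have hlim : Tendsto
      (fun t => contourIntegral γ (fun z => (f' t z * z ^ m) • resolvent T z)) (𝓝[<] (1 : ℝ))
      (𝓝 (contourIntegral γ (fun z => (f z * z ^ m) • resolvent T z))) := by
    have hu : uIoc (0 : ℝ) 1 = Ioc 0 1 := uIoc_of_le zero_le_one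
    refine intervalIntegral.tendsto_integral_filter_of_dominated_convergence
      (fun _ => L * (M * B)) ?_ ?_ (by simp) ?_
    · filter_upwards [hIco] with t ht
      rw [hu]
      have h1 : ContinuousOn (fun x => f' t (γ x)) (Icc 0 1) :=
        hf.continuousOn.comp (continuousOn_const.add
          ((hL.continuousOn.sub continuousOn_const).const_smul t))
          fun x hx => hmem t ht _ (hγ.inside x hx)
      have := aestronglyMeasurable_deriv_smul γ (h1.smul hhc)
      simpa only [Pi.smul_apply', smul_smul] using this
    · filter_upwards [hIco] with t ht
      have := ae_norm_deriv_smul_le hL (h := fun x => (f' t (γ x) * γ x ^ m) • resolvent T (γ x))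
        (B := M * B) (fun x hx => by
          rw [← smul_smul, norm_smul]
          have h1 := hfM _ (hmem t ht _ (hγ.inside x hx))
          exact mul_le_mul h1 (hB x hx) (norm_nonneg _) ((norm_nonneg _).trans h1))
      rwa [hu]
    · refine Eventually.of_forall fun x hx => ?_
      rw [hu] at hx
      have hcx : ContinuousAt (fun t : ℝ => f' t (γ x)) 1 := by
        refine ContinuousAt.comp (g := f) (f := fun t : ℝ => c + t • (γ x - c)) ?_ (by fun_prop)
        have e : c + (1 : ℝ) • (γ x - c) = γ x := by simp
        rw [e]
        exact hf.continuousOn.continuousAt (hΩo.mem_nhds (hγ.inside x ⟨hx.1.le, hx.2⟩))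
      have h1 : Tendsto (fun t : ℝ => f' t (γ x)) (𝓝[<] 1) (𝓝 (f (γ x))) := by
        have := hcx.tendsto
        simp only [hf', one_smul, add_sub_cancel] at this
        exact this.mono_left nhdsWithin_le_nhds
      exact ((h1.mul_const _).smul_const _).const_smul _
  refine le_of_tendsto (hlim.const_smul J⁻¹).norm ?_
  filter_upwards [Ioo_mem_nhdsLT (one_pos : (0 : ℝ) < 1)] with t ht
  have hD : IsOpen ((fun z : ℂ => c + t • (z - c)) ⁻¹' Ω) := hΩo.preimage (by fun_prop)
  refine norm_calculus_le hθ hθη hη0 hη hr hσ hb hD (c := c) ?_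
    (fun z hz => add_smul_sub_mem_keyhole hr hc hc' hz ht.1.le ht.2)
    (fun z hz => hmem t ⟨ht.1.le, ht.2⟩ z hz)
    (hf.comp (by fun_prop) fun z hz => hz) (fun z hz => hfM _ hz) hγ
  intro z hz p q hp hq hpq
  have hp' : (p : ℂ) = 1 - q := by rw [← Complex.ofReal_one, ← hpq]; push_cast; ring
  have e : c + t • ((p • c + q • z) - c) = p • c + q • (c + t • (z - c)) := by
    simp only [Complex.real_smul, hp']
    ring
  rw [mem_preimage, e]
  exact hstar hz hp hq hpq

end Main

end TadmorRitt

end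

theorem theorem1 {X : Type*} [NormedAddCommGroup X] [NormedSpace ℂ X] [CompleteSpace X]
    (T : X →L[ℂ] X) (hT : TadmorRitt.IsTadmorRitt T)
    (θ : ℝ) (hθ : θ = Real.arccos (1 / TadmorRitt.rittConst T))
    (m : ℕ) (r : ℝ) (hr : r ∈ Set.Ioo (0 : ℝ) 1)
    (η : ℝ) (hη : η ∈ Set.Ioo θ (Real.pi / 2)) :
    BddAbove (TadmorRitt.sectorValues T η) ∧
    ∀ f : ℂ → ℂ, DifferentiableOn ℂ f (TadmorRitt.keyhole η r) →
      BddAbove ((fun z => ‖f z‖) '' TadmorRitt.keyhole η r) →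
      ∃ A : X →L[ℂ] X,
        TadmorRitt.IsRieszDunford (TadmorRitt.closedStolz θ) (TadmorRitt.keyhole η r) T
          (fun z => f z * z ^ m) A ∧
        ‖A‖ ≤ TadmorRitt.sectorConst T η / (2 * Real.pi) * TadmorRitt.keyholeConst r m η
          * TadmorRitt.supNorm f (TadmorRitt.keyhole η r) := by
  have hπ := Real.pi_pos
  have hθ0 : 0 ≤ θ := hθ ▸ Real.arccos_nonneg _
  have hη0 : 0 < η := hθ0.trans_lt hη.1
  have hθC : Real.cos θ * TadmorRitt.rittConst T ≤ 1 :=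
    hθ ▸ TadmorRitt.cos_arccos_mul_rittConst_le T
  have hcos : Real.cos η < Real.cos θ :=
    Real.cos_lt_cos_of_nonneg_of_le_pi_div_two hθ0 hη.2.le hη.1
  have hsin : Real.sin θ < Real.sin η :=
    Real.sin_lt_sin_of_lt_of_le_pi_div_two (by linarith) hη.2.le hη.1
  have hsθ : 0 ≤ Real.sin θ := Real.sin_nonneg_of_nonneg_of_le_pi hθ0 (by linarith [hη.1, hη.2])
  have hcη : 0 < Real.cos η := Real.cos_pos_of_mem_Ioo ⟨by linarith, hη.2⟩
  have hηC : Real.cos η * TadmorRitt.rittConst T < 1 := by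
    rcases (TadmorRitt.rittConst_nonneg T).eq_or_lt with h | h
    · rw [← h]; simp
    · exact (mul_lt_mul_of_pos_right hcos h).trans_le hθC
  have hb := hT.bddAbove_sectorValues (hsθ.trans_lt hsin) hcη.le
    (hcos.trans_le (Real.cos_le_one θ)) hηC
  exact ⟨hb, fun f hf hfb => TadmorRitt.exists_calculus m hsθ hsin hη0 hη.2 hr.1
    (hT.spectrum_subset_closedStolz hsθ (hcη.trans hcos) hθC) hb hf hfb⟩
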